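/- Let $R$ be a commutative ring, $X=\operatorname{Spec}R$, and let $j:U\to X$ be an open immersion. Call a complex $\mathbb K$ of modules or sheaves in degrees $\ge 0$ acyclic if $H_i(\mathbb K)=0$ for all $i>0$. Let $$\mathbb G:\ 0\to G_n\xrightarrow{d_n} G_{n-1}\to\cdots\to G_1\to G_0$$ be a complex of free $R$-modules of finite rank, regarded as a complex of sheaves of $\mathcal O_X$-modules, and suppose that $\mathbb G|_U$ is acyclic. Then: 1. $H_n(\mathbb G\otimes_{\mathcal O_X} j_*\mathcal O_U)=0$ if $n\ge 1$, and $H_{n-1}(\mathbb G\otimes_{\mathcal O_X} j_*\mathcal O_U)=0$ if $n\ge 2$. 2. If $R^ij_*\mathcal O_U=0$ for all $1\le i\le n-2$, then $\mathbb G\otimes_{\mathcal O_X} j_*\mathcal O_U$ is acyclic. 3. Suppose moreover that $U$ is quasi-compact (automatic if $R$ is Noetherian) and that $X\setminus U\subseteq V(I(d_n))$, where $I(d_n)\subseteq R$ is the ideal generated by the maximal minors of $d_n$, that is by the minors of size $\operatorname{rank}G_n$. Then $\mathbb G\otimes_{\mathcal O_X} j_*\mathcal O_U$ is acyclic if and only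 if $R^ij_*\mathcal O_U=0$ for all $1\le i\le n-2$. -/

import Mathlib

open CategoryTheory AlgebraicGeometry

universe u

noncomputable section

/-- A chain complex is *acyclic* if its homology vanishes in all degrees `i > 0`
(its only possibly nonzero homology object is `H_0`). -/
def ChainComplex.IsAcyclic {C : Type*} [Category C] [Limits.HasZeroMorphisms C]
    (G : ChainComplex C ℕ) : Prop :=
  ∀ i : ℕ, 0 < i → G.ExactAt i

/-- The ideal of `R` generated by the maximal minors of a linear map `φ : M → N` between finite
free `R`-modules, that is by the `m × m` minors, `m = rank M`, of the matrix of `φ` in a pair of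
bases. (The ideal does not depend on the bases. A choice `s` of rows that is not injective
contributes the determinant `0`.) -/
def idealOfMaximalMinors {R : Type*} [CommRing R] {M N : Type*} [AddCommGroup M] [AddCommGroup N]
    [Module R M] [Module R N] [Module.Free R M] [Module.Finite R M] [Module.Free R N]
    [Module.Finite R N] (φ : M →ₗ[R] N) : Ideal R :=
  haveI := Classical.decEq (Module.Free.ChooseBasisIndex R M)
  Ideal.span (Set.range fun s : Module.Free.ChooseBasisIndex R M →
      Module.Free.ChooseBasisIndex R N ↦
    ((LinearMap.toMatrix (Module.Free.chooseBasis R M) (Module.Free.chooseBasis R N) φ).submatrix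
      s id).det)

namespace AlgebraicGeometry.Scheme.Modules

/-- The structure sheaf of a scheme as a sheaf of modules over itself. -/
def structureSheaf (X : Scheme.{u}) : X.Modules := SheafOfModules.unit X.ringCatSheaf

/-- The functor `(-) ⊗ F` on presheaves of modules: on sections over `V` it is
`M(V) ↦ M(V) ⊗ F(V)` over `Γ(X, V)`. -/
def presheafTensorRight {X : Scheme.{u}} (F : X.Modules) :
    X.PresheafOfModules ⥤ X.PresheafOfModules :=
  MonoidalCategory.tensorRight
    (C := _root_.PresheafOfModules.{u} (X.presheaf ⋙ forget₂ CommRingCat RingCat)) F.val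

/-- The sheaf of modules associated with a presheaf of modules on a scheme. -/
def sheafification (X : Scheme.{u}) : X.PresheafOfModules ⥤ X.Modules :=
  PresheafOfModules.sheafification (𝟙 X.ringCatSheaf.obj)

/-- The functor `(-) ⊗ F` on sheaves of modules on a scheme: the sheaf associated with the
presheaf tensor product. -/
def tensorRight {X : Scheme.{u}} (F : X.Modules) : X.Modules ⥤ X.Modules :=
  toPresheafOfModules X ⋙ presheafTensorRight F ⋙ sheafification X

instance {X : Scheme.{u}} (F : X.Modules) : (presheafTensorRight F).Additive where
  map_add {M N f g} := by
    ext V : 1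
    exact MonoidalPreadditive.add_whiskerRight (C := ModuleCat (X.presheaf.obj V))
      (f.app V) (g.app V)

instance (X : Scheme.{u}) : (toPresheafOfModules X).Additive where
  map_add := rfl

instance (X : Scheme.{u}) : (sheafification X).Additive :=
  (PresheafOfModules.sheafificationAdjunction (𝟙 X.ringCatSheaf.obj)).left_adjoint_additive

instance {X : Scheme.{u}} (F : X.Modules) : (tensorRight F).Additive :=
  inferInstanceAs (toPresheafOfModules X ⋙ presheafTensorRight F ⋙ sheafification X).Additive

/-- The underlying sheaf of abelian groups of a sheaf of modules on a scheme. -/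
def toAbSheaf {X : Scheme.{u}} (F : X.Modules) : TopCat.Sheaf AddCommGrpCat.{u} X :=
  (SheafOfModules.toSheaf X.ringCatSheaf).obj F

instance {X Y : TopCat.{u}} (f : X ⟶ Y) :
    (TopCat.Sheaf.pushforward AddCommGrpCat.{u} f).Additive where

/-- The higher direct image `Rⁱf_* F`: the value at `F` of the `i`-th right derived functor of
the direct image functor `f_*` on sheaves of abelian groups. -/
def higherDirectImage {X Y : Scheme.{u}} (f : X ⟶ Y) (i : ℕ) (F : X.Modules) :
    TopCat.Sheaf AddCommGrpCat.{u} Y :=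
  ((TopCat.Sheaf.pushforward AddCommGrpCat.{u} f.base).rightDerived i).obj (toAbSheaf F)

/-- A complex of `R`-modules, regarded as a complex of (quasi-coherent) sheaves on `Spec R`. -/
def tildeComplex {R : Type u} [CommRing R] (G : ChainComplex (ModuleCat.{u} R) ℕ) :
    ChainComplex (Spec (.of R)).Modules ℕ :=
  haveI : (tilde.functor (.of R)).Additive :=
    instAdditiveModuleCatCarrierModulesSpecOfFunctor
  ((tilde.functor (.of R)).mapHomologicalComplex _).obj G

instance {X U : Scheme.{u}} (j : U ⟶ X) [IsOpenImmersion j] : (restrictFunctor j).Additive where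
  map_add := rfl

/-- The restriction of a complex of sheaves of modules along an open immersion. -/
def restrictComplex {X U : Scheme.{u}} (j : U ⟶ X) [IsOpenImmersion j]
    (K : ChainComplex X.Modules ℕ) : ChainComplex U.Modules ℕ :=
  ((restrictFunctor j).mapHomologicalComplex _).obj K

/-- The complex `K ⊗ F` for a complex `K` of sheaves of modules and a sheaf of modules `F`. -/
def tensorComplex {X : Scheme.{u}} (K : ChainComplex X.Modules ℕ) (F : X.Modules) :
    ChainComplex X.Modules ℕ :=
  ((tensorRight F).mapHomologicalComplex _).obj K

/-- The complex `G ⊗ j_* 𝒪_U` of sheaves of modules on `X = Spec R`, for a complex `G` of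
`R`-modules and a morphism `j : U → X`. -/
def tensorDirectImage {R : Type u} [CommRing R] (G : ChainComplex (ModuleCat.{u} R) ℕ)
    {U : Scheme.{u}} (j : U ⟶ Spec (.of R)) : ChainComplex (Spec (.of R)).Modules ℕ :=
  tensorComplex (tildeComplex G) ((pushforward j).obj (structureSheaf U))

end AlgebraicGeometry.Scheme.Modules

end

/-! Let `C` be the complex of abelian sheaves on `U` obtained from `G`. Since the `G_i` are finite
free, `G ⊗ j_* 𝒪_U` is `j_* C`. For a point `x` of `Spec R`, the stalks at `x` of the presheaves `V
↦ Hⁱ(j⁻¹ V, F)` form a cohomological functor (`cohStalkFunctor`), written `Hⁱ(F)` here. Exactness of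
direct images can be read off from `H⁰` at all `x`, and for `i > 0` the sheaf `Rⁱj_* 𝒪_U` vanishes
exactly when `Hⁱ(𝒪_U) = 0` at all `x`.

As `C` is acyclic, its cycles give short exact sequences `0 → Z_{q+1} → C_{q+1} → Z_q → 0` for `q ≥
1`, and `Z_q = 0` if moreover `q ≥ n`. By the long exact sequence, `H⁰(C)` is exact in degree `p +
1` if and only if `H¹(Z_{p+2}) → H¹(C_{p+2})` is injective. For `p + 2 ≥ n` this is automatic, which
is the first assertion. If `Hⁱ(𝒪_U) = 0` for `1 ≤ i ≤ n - 2`, shifting dimensions gives `H¹(Z_{p+2})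
= 0`, which is the second.

For the converse in the third assertion, induct on `i`. When cohomology vanishes in degrees `1, …, i
- 1`, the injectivity for `H¹` shifts up to injectivity of `Hⁱ(C_n) → Hⁱ(C_{n-1})`
(`eq_zero_of_map_d_eq_zero`). This is the matrix of `d_n` acting on powers of `Hⁱ(𝒪_U)`, so by
McCoy's theorem with module coefficients an element killed by powers of all maximal minors is zero
(`eq_zero_of_forall_minor_pow`). Every `f` in `I(d_n)` satisfies `D(f) ⊆ U`, and for such `f` each
element of `Hⁱ(𝒪_U)` is killed by a power of `f` when `U` is quasi-compact.

This last fact rests on `torsion_succ`: a class in positive degree over a quasi-compact `W ⊇ D(f)`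
is killed by a power of `f`. With `W = D(f)` it contains the vanishing of cohomology on affines. It
is proved by induction on the degree: a class dies on a finite cover by basic opens `D(g)`, hence in
the cohomology of the product of the localizations `M_g`, and the kernel and cokernel of `M → ∏ M_g`
are then handled separately. -/

noncomputable section

open CategoryTheory TopologicalSpace Opposite Abelian

namespace TopCat.Sheaf

variable {X : TopCat.{u}}

/-! ### Sections of abelian sheaves and local criteria for exactness -/

section Sections

variable {F G K : TopCat.Sheaf AddCommGrpCat.{u} X} {U V W : Opens X}

/-- The sections of an abelian sheaf over an open subset. -/
abbrev Sec (F : TopCat.Sheaf AddCommGrpCat.{u} X) (V : Opens X) : Type u := F.obj.obj (op V)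

/-- Restriction of sections. -/
def rs (F : TopCat.Sheaf AddCommGrpCat.{u} X) (h : W ≤ V) : Sec F V →+ Sec F W :=
  (F.obj.map (homOfLE h).op).hom

/-- The action of a morphism of sheaves on sections. -/
def ap (φ : F ⟶ G) (V : Opens X) : Sec F V →+ Sec G V := (φ.hom.app (op V)).hom

@[simp] lemma rs_rfl (s : Sec F V) : rs F le_rfl s = s :=
  ConcreteCategory.congr_hom (F.obj.map_id (op V)) s

@[simp] lemma rs_rs (h : V ≤ U) (h' : W ≤ V) (s : Sec F U) :
    rs F h' (rs F h s) = rs F (h'.trans h) s :=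
  (ConcreteCategory.congr_hom (F.obj.map_comp (homOfLE h).op (homOfLE h').op) s).symm

lemma rs_ap (h : W ≤ V) (φ : F ⟶ G) (s : Sec F V) : rs G h (ap φ V s) = ap φ W (rs F h s) :=
  (ConcreteCategory.congr_hom (φ.hom.naturality (homOfLE h).op) s).symm

@[simp] lemma ap_id (s : Sec F V) : ap (𝟙 F) V s = s := rfl

lemma ap_comp (φ : F ⟶ G) (ψ : G ⟶ K) (s : Sec F V) : ap (φ ≫ ψ) V s = ap ψ V (ap φ V s) := rfl

@[simp] lemma ap_zero (s : Sec F V) : ap (0 : F ⟶ G) V s = 0 := rfl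

lemma ap_comp_eq_zero {φ : F ⟶ G} {ψ : G ⟶ K} (h : φ ≫ ψ = 0) (s : Sec F V) :
    ap ψ V (ap φ V s) = 0 := by rw [← ap_comp, h, ap_zero]

lemma sec_ext {s t : Sec F V} (h : ∀ x ∈ V, ∃ (W : Opens X) (hW : W ≤ V), x ∈ W ∧
    rs F hW s = rs F hW t) : s = t := by
  choose W hW hx e using h
  refine TopCat.Sheaf.eq_of_locally_eq' F (fun x : V ↦ W x x.2) V (fun x ↦ homOfLE (hW x x.2))
    (fun x hx' ↦ ?_) s t (fun x ↦ e x x.2)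
  simp only [Opens.mem_iSup]
  exact ⟨⟨x, hx'⟩, hx x hx'⟩

end Sections

/-- The free abelian sheaf generated by (the sheaf represented by) an open subset. -/
def freeOpen (X : TopCat.{u}) : Opens X ⥤ TopCat.Sheaf AddCommGrpCat.{u} X :=
  yoneda ⋙ (Functor.whiskeringRight _ _ _).obj AddCommGrpCat.free ⋙
    presheafToSheaf (Opens.grothendieckTopology X) AddCommGrpCat.{u}

/-- Morphisms from the free abelian sheaf on `V` to `F` are sections of `F` over `V`. -/
def freeOpenEquiv (V : Opens X) (F : TopCat.Sheaf AddCommGrpCat.{u} X) :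
    ((freeOpen X).obj V ⟶ F) ≃ Sec F V :=
  ((sheafificationAdjunction (Opens.grothendieckTopology X) AddCommGrpCat.{u}).homEquiv _ F).trans
    (((AddCommGrpCat.adj.whiskerRight (Opens X)ᵒᵖ).homEquiv _ _).trans yonedaEquiv)

lemma freeOpenEquiv_comp {V : Opens X} {F G : TopCat.Sheaf AddCommGrpCat.{u} X}
    (x : (freeOpen X).obj V ⟶ F) (φ : F ⟶ G) :
    freeOpenEquiv V G (x ≫ φ) = ap φ V (freeOpenEquiv V F x) := by
  let a := sheafificationAdjunction (Opens.grothendieckTopology X) AddCommGrpCat.{u}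
  let b := AddCommGrpCat.adj.{u}.whiskerRight (Opens X)ᵒᵖ
  have h₁ : a.homEquiv _ G (x ≫ φ) = a.homEquiv _ F x ≫ φ.hom := a.homEquiv_naturality_right x φ
  have h₂ := b.homEquiv_naturality_right (a.homEquiv _ F x) φ.hom
  exact congrArg yonedaEquiv ((congrArg (b.homEquiv _ _) h₁).trans h₂)

/-- The tautological section of the free abelian sheaf on `V`. -/
def gen (V : Opens X) : Sec ((freeOpen X).obj V) V := freeOpenEquiv V _ (𝟙 _)

lemma freeOpenEquiv_apply {V : Opens X} {F : TopCat.Sheaf AddCommGrpCat.{u} X}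
    (x : (freeOpen X).obj V ⟶ F) : freeOpenEquiv V F x = ap x V (gen V) := by
  rw [gen, ← freeOpenEquiv_comp, Category.id_comp]

lemma freeOpenEquiv_add {V : Opens X} {F : TopCat.Sheaf AddCommGrpCat.{u} X}
    (x y : (freeOpen X).obj V ⟶ F) :
    freeOpenEquiv V F (x + y) = freeOpenEquiv V F x + freeOpenEquiv V F y := by
  simp only [freeOpenEquiv_apply]
  rfl

lemma freeOpenEquiv_map_comp {V W : Opens X} (h : W ≤ V) {F : TopCat.Sheaf AddCommGrpCat.{u} X}
    (x : (freeOpen X).obj V ⟶ F) :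
    freeOpenEquiv W F ((freeOpen X).map (homOfLE h) ≫ x) = rs F h (freeOpenEquiv V F x) := by
  let a := sheafificationAdjunction (Opens.grothendieckTopology X) AddCommGrpCat.{u}
  let b := AddCommGrpCat.adj.{u}.whiskerRight (Opens X)ᵒᵖ
  let L := (Functor.whiskeringRight (Opens X)ᵒᵖ _ _).obj AddCommGrpCat.free.{u}
  have h₁ : a.homEquiv _ F ((freeOpen X).map (homOfLE h) ≫ x) = L.map (yoneda.map (homOfLE h)) ≫ a.homEquiv _ F x :=
    a.homEquiv_naturality_left _ x
  have h₂ := b.homEquiv_naturality_left (yoneda.map (homOfLE h)) (a.homEquiv _ F x)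
  exact (congrArg yonedaEquiv ((congrArg (b.homEquiv _ _) h₁).trans h₂)).trans
    (yonedaEquiv_naturality _ (homOfLE h)).symm

/-- Exactness of a complex of abelian sheaves means that cycles lift locally to boundaries. -/
lemma exact_iff_local (S : ShortComplex (TopCat.Sheaf AddCommGrpCat.{u} X)) :
    S.Exact ↔ ∀ (V : Opens X) (s : Sec S.X₂ V), ap S.g V s = 0 → ∀ x ∈ V,
      ∃ (W : Opens X) (h : W ≤ V) (t : Sec S.X₁ W), x ∈ W ∧ ap S.f W t = rs S.X₂ h s := by
  let γ (F : TopCat.Sheaf AddCommGrpCat.{u} X) {V : Opens X} {x : X} (hx : x ∈ V) :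
      Sec F V →+ Presheaf.stalk (C := AddCommGrpCat.{u}) F.obj x := (Presheaf.germ F.obj V x hx).hom
  have γ_ap {F G : TopCat.Sheaf AddCommGrpCat.{u} X} (φ : F ⟶ G) {V : Opens X} {x : X}
      (hx : x ∈ V) (s : Sec F V) :
      (Presheaf.stalkFunctor AddCommGrpCat x).map φ.hom (γ F hx s) = γ G hx (ap φ V s) :=
    Presheaf.stalkFunctor_map_germ_apply V x hx φ.hom s
  have γ_rs (F : TopCat.Sheaf AddCommGrpCat.{u} X) {V W : Opens X} {x : X}
      (h : W ≤ V) (hx : x ∈ W) (s : Sec F V) : γ F hx (rs F h s) = γ F (h hx) s :=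
    Presheaf.germ_res_apply F.obj (homOfLE h) x hx s
  have γ_surj (F : TopCat.Sheaf AddCommGrpCat.{u} X) {x : X} (t : Presheaf.stalk (C := AddCommGrpCat.{u}) F.obj x) :
      ∃ (V : Opens X) (hx : x ∈ V) (s : Sec F V), γ F hx s = t := Presheaf.exists_germ_eq F.obj t
  have γ_eq (F : TopCat.Sheaf AddCommGrpCat.{u} X) {V W : Opens X} {x : X}
      (hV : x ∈ V) (hW : x ∈ W) (s : Sec F V) (t : Sec F W) (h : γ F hV s = γ F hW t) :
      ∃ (U : Opens X) (hUV : U ≤ V) (hUW : U ≤ W), x ∈ U ∧ rs F hUV s = rs F hUW t := by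
    obtain ⟨U, hU, i, k, e⟩ := Presheaf.germ_eq F.obj x hV hW s t h
    exact ⟨U, i.le, k.le, hU, e⟩
  -- Exactness is tested on stalks; `γ` denotes germs, and both directions transport the condition
  -- between germs and representing sections.
  rw [exact_iff_stalkFunctor_map_exact]
  simp only [ShortComplex.ab_exact_iff]
  constructor
  · intro H V s hs x hx
    obtain ⟨t, ht⟩ := H x (γ S.X₂ hx s) ((γ_ap S.g hx s).trans
      ((congrArg (γ S.X₃ hx) hs).trans (map_zero (γ S.X₃ hx))))
    obtain ⟨W, hW, t, rfl⟩ := γ_surj S.X₁ t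
    obtain ⟨U, hUW, hUV, hxU, h⟩ := γ_eq S.X₂ hW hx _ _ ((γ_ap S.f hW t).symm.trans ht)
    exact ⟨U, hUV, rs S.X₁ hUW t, hxU, by rw [← h, rs_ap]⟩
  · intro H x s hs
    obtain ⟨V, hV, s, rfl⟩ := γ_surj S.X₂ s
    obtain ⟨U, hUV, _, hxU, h⟩ := γ_eq S.X₃ hV hV (ap S.g V s) 0
      ((γ_ap S.g hV s).symm.trans (hs.trans (map_zero (γ S.X₃ hV)).symm))
    rw [map_zero, rs_ap] at h
    obtain ⟨W, hW, t, hxW, ht⟩ := H U _ h x hxU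
    refine ⟨γ S.X₁ hxW t, (γ_ap S.f hxW t).trans ?_⟩
    rw [ht, γ_rs, γ_rs]

lemma epi_iff_local {F G : TopCat.Sheaf AddCommGrpCat.{u} X} (φ : F ⟶ G) :
    Epi φ ↔ ∀ (V : Opens X) (s : Sec G V), ∀ x ∈ V,
      ∃ (W : Opens X) (h : W ≤ V) (t : Sec F W), x ∈ W ∧ ap φ W t = rs G h s := by
  rw [← ShortComplex.exact_iff_epi (ShortComplex.mk φ (0 : G ⟶ G) (by simp)) rfl, exact_iff_local]
  simp

lemma mono_iff_injective {F G : TopCat.Sheaf AddCommGrpCat.{u} X} (φ : F ⟶ G) :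
    Mono φ ↔ ∀ (V : Opens X) (s : Sec F V), ap φ V s = 0 → s = 0 := by
  rw [← ShortComplex.exact_iff_mono (ShortComplex.mk (0 : F ⟶ F) φ (by simp)) rfl, exact_iff_local]
  constructor
  · intro H V s hs
    refine sec_ext fun x hx ↦ ?_
    obtain ⟨W, h, t, hxW, ht⟩ := H V s hs x hx
    exact ⟨W, h, hxW, by rw [← ht]; simp⟩
  · intro H V s hs x hx
    refine ⟨V, le_rfl, 0, hx, ?_⟩
    rw [H V s hs]
    simp

lemma exists_sec_of_shortExact {S : ShortComplex (TopCat.Sheaf AddCommGrpCat.{u} X)}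
    (hS : S.ShortExact) {V : Opens X} (s : Sec S.X₂ V) (hs : ap S.g V s = 0) :
    ∃ t, ap S.f V t = s :=
  TopCat.Sheaf.sections_exact_of_left_exact hS.exact hS.mono_f s hs

/-! ### Cohomology over open subsets as Ext out of free sheaves -/

/-- The cohomology of an abelian sheaf over an open subset. -/
abbrev Coh (F : TopCat.Sheaf AddCommGrpCat.{u} X) (V : Opens X) (i : ℕ) : Type u :=
  Ext.{u} ((freeOpen X).obj V) F i

namespace Coh

variable {F G : TopCat.Sheaf AddCommGrpCat.{u} X} {V W : Opens X} {i : ℕ}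

/-- Restriction of cohomology classes. -/
def res (F : TopCat.Sheaf AddCommGrpCat.{u} X) (i : ℕ) (h : W ≤ V) : Coh F V i →+ Coh F W i :=
  (Ext.mk₀ ((freeOpen X).map (homOfLE h))).precomp F (zero_add i)

/-- Functoriality of cohomology in the sheaf. -/
def map (V : Opens X) (i : ℕ) (φ : F ⟶ G) : Coh F V i →+ Coh G V i :=
  (Ext.mk₀ φ).postcomp _ (add_zero i)

/-- The connecting homomorphism. -/
def δ {S : ShortComplex (TopCat.Sheaf AddCommGrpCat.{u} X)} (hS : S.ShortExact) (V : Opens X)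
    (i : ℕ) : Coh S.X₃ V i →+ Coh S.X₁ V (i + 1) :=
  hS.extClass.postcomp _ rfl

/-- Sections are the cohomology classes of degree zero. -/
def sec (F : TopCat.Sheaf AddCommGrpCat.{u} X) (V : Opens X) : Sec F V ≃+ Coh F V 0 :=
  ((AddEquiv.mk' (freeOpenEquiv V F) freeOpenEquiv_add).symm).trans Ext.addEquiv₀.symm

lemma sec_apply (s : Sec F V) :
    sec F V s = Ext.mk₀ ((freeOpenEquiv V F).symm s) := rfl

@[simp] lemma res_sec (h : W ≤ V) (s : Sec F V) :
    res F 0 h (sec F V s) = sec F W (rs F h s) := by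
  have : (freeOpenEquiv W F).symm (rs F h s) =
      (freeOpen X).map (homOfLE h) ≫ (freeOpenEquiv V F).symm s := by
    rw [Equiv.symm_apply_eq, freeOpenEquiv_map_comp, Equiv.apply_symm_apply]
  simp [res, sec_apply, this]

@[simp] lemma map_sec (φ : F ⟶ G) (s : Sec F V) :
    map V 0 φ (sec F V s) = sec G V (ap φ V s) := by
  have : (freeOpenEquiv V G).symm (ap φ V s) = (freeOpenEquiv V F).symm s ≫ φ := by
    rw [Equiv.symm_apply_eq, freeOpenEquiv_comp, Equiv.apply_symm_apply]
  simp [map, sec_apply, this]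

@[simp] lemma res_rfl (ξ : Coh F V i) : res F i le_rfl ξ = ξ := by
  simp [res]

lemma res_res {W' : Opens X} (h : W ≤ V) (h' : W' ≤ W) (ξ : Coh F V i) :
    res F i h' (res F i h ξ) = res F i (h'.trans h) ξ := by
  have : (freeOpen X).map (homOfLE (h'.trans h)) =
      (freeOpen X).map (homOfLE h') ≫ (freeOpen X).map (homOfLE h) := by
    rw [← Functor.map_comp]; rfl
  simp [res, this]

@[simp] lemma map_id (ξ : Coh F V i) : map V i (𝟙 F) ξ = ξ := by simp [map]

lemma map_comp {K : TopCat.Sheaf AddCommGrpCat.{u} X} (φ : F ⟶ G) (ψ : G ⟶ K) (ξ : Coh F V i) :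
    map V i (φ ≫ ψ) ξ = map V i ψ (map V i φ ξ) := by simp [map]

lemma map_add (φ ψ : F ⟶ G) (ξ : Coh F V i) :
    map V i (φ + ψ) ξ = map V i φ ξ + map V i ψ ξ := by simp [map, Ext.mk₀_add]

lemma res_map (h : W ≤ V) (φ : F ⟶ G) (ξ : Coh F V i) :
    res G i h (map V i φ ξ) = map W i φ (res F i h ξ) := by
  simp [res, map]

variable {S T : ShortComplex (TopCat.Sheaf AddCommGrpCat.{u} X)}

lemma res_δ (hS : S.ShortExact) (h : W ≤ V) (ξ : Coh S.X₃ V i) :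
    res S.X₁ (i + 1) h (δ hS V i ξ) = δ hS W i (res S.X₃ i h ξ) := by
  exact (Ext.comp_assoc _ ξ hS.extClass (zero_add i) rfl (by omega)).symm

lemma map_δ (hS : S.ShortExact) (hT : T.ShortExact) (φ : S ⟶ T) (ξ : Coh S.X₃ V i) :
    map V (i + 1) φ.τ₁ (δ hS V i ξ) = δ hT V i (map V i φ.τ₃ ξ) := by
  refine (Ext.comp_assoc ξ hS.extClass (Ext.mk₀ φ.τ₁) rfl (add_zero 1) (by omega)).trans ?_
  rw [ShortComplex.ShortExact.extClass_naturality hS hT φ]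
  exact (Ext.comp_assoc ξ (Ext.mk₀ φ.τ₃) hT.extClass (add_zero i) (zero_add 1) (by omega)).symm

lemma exact₁ (hS : S.ShortExact) (ξ : Coh S.X₁ V (i + 1)) (h : map V (i + 1) S.f ξ = 0) :
    ∃ η, δ hS V i η = ξ := Ext.covariant_sequence_exact₁ _ hS ξ h rfl

lemma exact₂ (hS : S.ShortExact) (ξ : Coh S.X₂ V i) (h : map V i S.g ξ = 0) :
    ∃ η, map V i S.f η = ξ := Ext.covariant_sequence_exact₂ _ hS ξ h

lemma exact₃ (hS : S.ShortExact) (ξ : Coh S.X₃ V i) (h : δ hS V i ξ = 0) :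
    ∃ η, map V i S.g η = ξ := Ext.covariant_sequence_exact₃ _ hS ξ rfl h

lemma δ_map (hS : S.ShortExact) (ξ : Coh S.X₂ V i) : δ hS V i (map V i S.g ξ) = 0 := by
  simp [δ, map]

lemma map_f_δ (hS : S.ShortExact) (ξ : Coh S.X₃ V i) : map V (i + 1) S.f (δ hS V i ξ) = 0 := by
  simp [δ, map]

lemma eq_zero_of_injective [Injective F] (ξ : Coh F V (i + 1)) : ξ = 0 :=
  Ext.eq_zero_of_injective ξ

end Coh

end TopCat.Sheaf

end

/-! ### Cohomology classes as cocycles, and higher direct images -/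

noncomputable section

open CategoryTheory TopologicalSpace Opposite Abelian

namespace TopCat.Sheaf

variable {X : TopCat.{u}}

namespace Coh

section InjectiveResolution

variable {F : TopCat.Sheaf AddCommGrpCat.{u} X} (I : InjectiveResolution F) {V : Opens X} {i : ℕ}

/-- Ext is computed by the injective resolution. One class serves for all `W ≤ V` simultaneously,
which is what allows local vanishing of classes to be compared with local exactness of the
resolution or of its direct image. -/
lemma exists_class_of_cocycle (s : Sec (I.cocomplex.X (i + 1)) V)
    (hs : ap (I.cocomplex.d (i + 1) (i + 2)) V s = 0) :
    ∃ ξ : Coh F V (i + 1), ∀ (W : Opens X) (h : W ≤ V), res F (i + 1) h ξ = 0 ↔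
      ∃ t, ap (I.cocomplex.d i (i + 1)) W t = rs _ h s := by
  let z := (freeOpenEquiv V _).symm s
  have hz : z ≫ I.cocomplex.d (i + 1) (i + 2) = 0 := by
    apply (freeOpenEquiv V _).injective
    rw [freeOpenEquiv_comp, Equiv.apply_symm_apply, hs, freeOpenEquiv_apply, ap_zero]
  refine ⟨I.extMk z _ rfl hz, fun W h ↦ ?_⟩
  have : res F (i + 1) h (I.extMk z _ rfl hz) =
      I.extMk ((freeOpen X).map (homOfLE h) ≫ z) _ rfl (by simp [hz]) :=
    I.mk₀_comp_extMk z _ rfl hz _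
  rw [this, I.extMk_eq_zero_iff _ _ _ _ i rfl]
  constructor
  · rintro ⟨g, hg⟩
    refine ⟨freeOpenEquiv W _ g, ?_⟩
    rw [← freeOpenEquiv_comp, hg, freeOpenEquiv_map_comp, Equiv.apply_symm_apply]
  · rintro ⟨t, ht⟩
    refine ⟨(freeOpenEquiv W _).symm t, ?_⟩
    apply (freeOpenEquiv W _).injective
    rw [freeOpenEquiv_comp, freeOpenEquiv_map_comp, Equiv.apply_symm_apply, ht,
      Equiv.apply_symm_apply]

lemma exists_cocycle_of_class (ξ : Coh F V (i + 1)) :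
    ∃ s : Sec (I.cocomplex.X (i + 1)) V, ap (I.cocomplex.d (i + 1) (i + 2)) V s = 0 ∧
      ∀ (W : Opens X) (h : W ≤ V), res F (i + 1) h ξ = 0 ↔
        ∃ t, ap (I.cocomplex.d i (i + 1)) W t = rs _ h s := by
  obtain ⟨z, hz, rfl⟩ := I.extMk_surjective ξ _ rfl
  refine ⟨freeOpenEquiv V _ z, ?_, fun W h ↦ ?_⟩
  · rw [← freeOpenEquiv_comp, hz, freeOpenEquiv_apply, ap_zero]
  have : res F (i + 1) h (I.extMk z _ rfl hz) =
      I.extMk ((freeOpen X).map (homOfLE h) ≫ z) _ rfl (by simp [hz]) :=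
    I.mk₀_comp_extMk z _ rfl hz _
  rw [this, I.extMk_eq_zero_iff _ _ _ _ i rfl]
  constructor
  · rintro ⟨g, hg⟩
    refine ⟨freeOpenEquiv W _ g, ?_⟩
    rw [← freeOpenEquiv_comp, hg, freeOpenEquiv_map_comp]
  · rintro ⟨t, ht⟩
    refine ⟨(freeOpenEquiv W _).symm t, ?_⟩
    apply (freeOpenEquiv W _).injective
    rw [freeOpenEquiv_comp, freeOpenEquiv_map_comp, Equiv.apply_symm_apply, ht]

end InjectiveResolution

/-- Cohomology classes of positive degree vanish locally. -/
lemma exists_res_eq_zero {F : TopCat.Sheaf AddCommGrpCat.{u} X} {V : Opens X} {i : ℕ}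
    (ξ : Coh F V (i + 1)) {x : X} (hx : x ∈ V) :
    ∃ (W : Opens X) (h : W ≤ V), x ∈ W ∧ res F (i + 1) h ξ = 0 := by
  obtain ⟨s, hs, H⟩ := exists_cocycle_of_class (injectiveResolution F) ξ
  obtain ⟨W, h, t, hxW, ht⟩ :=
    (exact_iff_local _).1 ((injectiveResolution F).exact_succ i) V s hs x hx
  exact ⟨W, h, hxW, (H W h).2 ⟨t, ht⟩⟩

end Coh

/-- A higher direct image vanishes if and only if the corresponding cohomology classes on inverse
images of open subsets vanish locally on the target. -/
lemma isZero_rightDerived_pushforward_iff {Y : TopCat.{u}} (f : X ⟶ Y)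
    (F : TopCat.Sheaf AddCommGrpCat.{u} X) (i : ℕ) :
    Limits.IsZero (((TopCat.Sheaf.pushforward AddCommGrpCat.{u} f).rightDerived (i + 1)).obj F) ↔
      ∀ (V : Opens Y) (ξ : Coh F ((Opens.map f).obj V) (i + 1)), ∀ y ∈ V,
        ∃ (W : Opens Y) (h : W ≤ V), y ∈ W ∧
          Coh.res F (i + 1) ((Opens.map f).map (homOfLE h)).le ξ = 0 := by
  let I := injectiveResolution F
  let P := TopCat.Sheaf.pushforward AddCommGrpCat.{u} f
  have h₁ := (I.isoRightDerivedObj P (i + 1)).isZero_iff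
  rw [h₁]
  -- The derived functor is the cohomology of the direct image of `I`, whose sections over `V` are
  -- those of `I` over the inverse image of `V`.
  have h₂ := ((P.mapHomologicalComplex _).obj I.cocomplex).exactAt_iff_isZero_homology (i + 1)
  refine h₂.symm.trans ?_
  rw [HomologicalComplex.exactAt_iff' _ i (i + 1) (i + 2) (by simp) (by simp), exact_iff_local]
  constructor
  · intro H V ξ y hy
    obtain ⟨s, hs, hξ⟩ := Coh.exists_cocycle_of_class I ξ
    obtain ⟨W, h, t, hyW, ht⟩ := H V s hs y hy
    exact ⟨W, h, hyW, (hξ _ _).2 ⟨t, ht⟩⟩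
  · intro H V s hs y hy
    obtain ⟨ξ, hξ⟩ := Coh.exists_class_of_cocycle I (V := (Opens.map f).obj V) s hs
    obtain ⟨W, h, hyW, hW⟩ := H V ξ y hy
    obtain ⟨t, ht⟩ := (hξ _ _).1 hW
    exact ⟨W, h, t, hyW, ht⟩

/-! ### Flasque sheaves and dimension shifting -/

section Flasque

/-- Every section of `F` over an open subset of `W` extends to `W`. -/
def IsFlasqueOn (F : TopCat.Sheaf AddCommGrpCat.{u} X) (W : Opens X) : Prop :=
  ∀ (V : Opens X) (h : V ≤ W), Function.Surjective (rs F h)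

/-- A section over `V` is a morphism from the free sheaf on `V`, which embeds into the free sheaf on
`W`; injectivity of `F` extends the morphism. -/
lemma isFlasqueOn_of_injective (F : TopCat.Sheaf AddCommGrpCat.{u} X) [Injective F]
    (W : Opens X) : IsFlasqueOn F W := by
  intro V h s
  have : Mono ((freeOpen X).map (homOfLE h)) := by
    have : Mono (((Functor.whiskeringRight (Opens X)ᵒᵖ _ _).obj AddCommGrpCat.free.{u}).map
        (yoneda.map (homOfLE h))) := by
      have (U : (Opens X)ᵒᵖ) : Mono ((((Functor.whiskeringRight (Opens X)ᵒᵖ _ _).obj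
        AddCommGrpCat.free.{u}).map (yoneda.map (homOfLE h))).app U) :=
        inferInstanceAs (Mono (AddCommGrpCat.free.{u}.map ((yoneda.map (homOfLE h)).app U)))
      exact NatTrans.mono_of_mono_app _
    exact inferInstanceAs (Mono ((presheafToSheaf _ _).map
      (((Functor.whiskeringRight (Opens X)ᵒᵖ _ _).obj AddCommGrpCat.free.{u}).map
        (yoneda.map (homOfLE h)))))
  refine ⟨freeOpenEquiv W F (Injective.factorThru ((freeOpenEquiv V F).symm s)
    ((freeOpen X).map (homOfLE h))), ?_⟩
  rw [← freeOpenEquiv_map_comp, Injective.comp_factorThru, Equiv.apply_symm_apply]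

/-- The restriction of abelian sheaves to an open subset. -/
def restrictOpen (D : Opens X) : TopCat.Sheaf AddCommGrpCat.{u} X ⥤
    TopCat.Sheaf AddCommGrpCat.{u} ((Opens.toTopCat X).obj D) :=
  haveI := D.isOpenEmbedding.functor_isContinuous
  D.isOpenEmbedding.functor.sheafPushforwardContinuous AddCommGrpCat.{u}
    (Opens.grothendieckTopology ((Opens.toTopCat X).obj D)) (Opens.grothendieckTopology X)

instance (D : Opens X) : (restrictOpen D).Additive where

lemma functor_obj_le (D : Opens X) (V : Opens ((Opens.toTopCat X).obj D)) :
    D.isOpenEmbedding.functor.obj V ≤ D := by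
  rintro _ ⟨y, -, rfl⟩
  exact y.2

lemma mem_functor_obj (D : Opens X) {V : Opens ((Opens.toTopCat X).obj D)} {y : D} (hy : y ∈ V) :
    (y : X) ∈ D.isOpenEmbedding.functor.obj V := ⟨y, hy, rfl⟩

lemma exact_restrictOpen {S : ShortComplex (TopCat.Sheaf AddCommGrpCat.{u} X)} (hS : S.Exact)
    (D : Opens X) : (S.map (restrictOpen D)).Exact := by
  rw [exact_iff_local] at hS ⊢
  intro V s hs x hx
  obtain ⟨W, h, t, hxW, ht⟩ := hS (D.isOpenEmbedding.functor.obj V) s hs _ (mem_functor_obj D hx)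
  let W' := (Opens.map D.inclusion').obj W
  have hW' : D.isOpenEmbedding.functor.obj W' ≤ W := by
    rintro _ ⟨y, hy, rfl⟩
    exact hy
  have hW'V : W' ≤ V := by
    intro y hy
    obtain ⟨z, hz, e⟩ := h hy
    have : z = y := Subtype.ext e
    exact this ▸ hz
  refine ⟨W', hW'V, rs S.X₁ hW' t, hxW, ?_⟩
  have e₁ : ap S.f _ (rs S.X₁ hW' t) = rs S.X₂ hW' (ap S.f W t) := (rs_ap hW' S.f t).symm
  exact e₁.trans ((congrArg (rs S.X₂ hW') ht).trans (rs_rs h hW' _))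

lemma shortExact_restrictOpen {S : ShortComplex (TopCat.Sheaf AddCommGrpCat.{u} X)}
    (hS : S.ShortExact) (D : Opens X) : (S.map (restrictOpen D)).ShortExact where
  exact := exact_restrictOpen hS.exact D
  mono_f := by
    have := hS.mono_f
    rw [mono_iff_injective] at this ⊢
    exact fun V s hs ↦ this _ s hs
  epi_g := by
    have h := (ShortComplex.exact_iff_epi (ShortComplex.mk S.g (0 : S.X₃ ⟶ S.X₃) (by simp)) rfl).2
      hS.epi_g
    have h' := exact_restrictOpen h D
    exact (ShortComplex.exact_iff_epi _ ((restrictOpen D).map_zero _ _)).1 h'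

lemma IsFlasqueOn.restrictOpen {F : TopCat.Sheaf AddCommGrpCat.{u} X} {W : Opens X}
    (hF : IsFlasqueOn F W) : IsFlasque ((restrictOpen W).obj F) where
  epi {U V} i := by
    rw [AddCommGrpCat.epi_iff_surjective]
    intro s
    obtain ⟨t, ht⟩ := hF _ (functor_obj_le W V.unop) s
    have e : rs F (W.isOpenEmbedding.functor.map i.unop).le (rs F (functor_obj_le W U.unop) t) = s :=
      (rs_rs _ _ t).trans ht
    exact ⟨rs F (functor_obj_le W U.unop) t, e⟩

lemma IsFlasqueOn.surjective_of_shortExact {S : ShortComplex (TopCat.Sheaf AddCommGrpCat.{u} X)}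
    (hS : S.ShortExact) {W : Opens X} (h : IsFlasqueOn S.X₁ W) :
    Function.Surjective (ap S.g W) := by
  intro s
  have := h.restrictOpen
  have : IsFlasque (S.map (Sheaf.restrictOpen W)).X₁ := this
  -- On the space `W` the restricted sheaf is flasque, so global sections there are exact; `e`
  -- identifies them with the sections over `W`.
  have e : W.isOpenEmbedding.functor.obj ⊤ = W := W.isOpenEmbedding_obj_top
  have h' := IsFlasque.epi_of_shortExact (U := ⊤) (shortExact_restrictOpen hS W)
  rw [AddCommGrpCat.epi_iff_surjective] at h'
  obtain ⟨t, ht⟩ : ∃ t : Sec S.X₂ (W.isOpenEmbedding.functor.obj ⊤),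
      ap S.g _ t = rs S.X₃ e.le s := h' (rs S.X₃ e.le s)
  refine ⟨rs S.X₂ e.ge t, ?_⟩
  rw [← rs_ap, ht, rs_rs, rs_rfl]

lemma IsFlasqueOn.mono {F : TopCat.Sheaf AddCommGrpCat.{u} X} {V W : Opens X}
    (hF : IsFlasqueOn F W) (h : V ≤ W) : IsFlasqueOn F V := by
  intro U hU s
  obtain ⟨t, rfl⟩ := hF U (hU.trans h) s
  exact ⟨rs F h t, rs_rs _ _ _⟩

lemma IsFlasqueOn.of_shortExact {S : ShortComplex (TopCat.Sheaf AddCommGrpCat.{u} X)}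
    (hS : S.ShortExact) {W : Opens X} (h₁ : IsFlasqueOn S.X₁ W) (h₂ : IsFlasqueOn S.X₂ W) :
    IsFlasqueOn S.X₃ W := by
  intro V h s
  obtain ⟨t, rfl⟩ := (h₁.mono h).surjective_of_shortExact hS s
  obtain ⟨t, rfl⟩ := h₂ V h t
  exact ⟨ap S.g W t, rs_ap _ _ _⟩

/-- The short complex given by an embedding into an injective sheaf and its cokernel. -/
abbrev injectiveShift (F : TopCat.Sheaf AddCommGrpCat.{u} X) :
    ShortComplex (TopCat.Sheaf AddCommGrpCat.{u} X) :=
  ShortComplex.mk (Injective.ι F) (Limits.cokernel.π (Injective.ι F)) (by simp)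

lemma injectiveShift_shortExact (F : TopCat.Sheaf AddCommGrpCat.{u} X) :
    (injectiveShift F).ShortExact where
  exact := ShortComplex.exact_cokernel _
  mono_f := by dsimp; infer_instance
  epi_g := by dsimp; infer_instance

/-- The injective middle term has no positive cohomology, so every class of positive degree is a
coboundary. This drives the inductions on the degree. -/
lemma Coh.exists_δ_eq (F : TopCat.Sheaf AddCommGrpCat.{u} X) {V : Opens X} {i : ℕ}
    (ξ : Coh F V (i + 1)) : ∃ η, Coh.δ (injectiveShift_shortExact F) V i η = ξ := by
  have : Injective (injectiveShift F).X₂ := inferInstanceAs (Injective (Injective.under F))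
  exact Coh.exact₁ (injectiveShift_shortExact F) ξ (Coh.eq_zero_of_injective _)

/-- Sheaves whose restriction to `W` is flasque have no cohomology over `W`. -/
lemma IsFlasqueOn.coh_eq_zero {W : Opens X} {i : ℕ} :
    ∀ {F : TopCat.Sheaf AddCommGrpCat.{u} X}, IsFlasqueOn F W → ∀ ξ : Coh F W (i + 1), ξ = 0 := by
  induction i with
  | zero =>
    intro F hF ξ
    obtain ⟨η, rfl⟩ := Coh.exists_δ_eq F ξ
    obtain ⟨s, rfl⟩ := (Coh.sec _ _).surjective η
    obtain ⟨t, rfl⟩ := IsFlasqueOn.surjective_of_shortExact (injectiveShift_shortExact F) hF s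
    rw [← Coh.map_sec, Coh.δ_map]
  | succ i ih =>
    intro F hF ξ
    obtain ⟨η, rfl⟩ := Coh.exists_δ_eq F ξ
    rw [ih (IsFlasqueOn.of_shortExact (injectiveShift_shortExact F) hF
      (isFlasqueOn_of_injective (Injective.under F) W)) η, map_zero]

end Flasque

/-! ### Comparing `F` with the sheaf `V ↦ F(V ∩ D)` -/

section Cut

/-- The intersection of two open subsets, as the image of the inverse image. -/
def cut (D V : Opens X) : Opens X :=
  D.isOpenEmbedding.functor.obj ((Opens.map D.inclusion').obj V)

lemma mem_cut {D V : Opens X} {x : X} : x ∈ cut D V ↔ x ∈ D ∧ x ∈ V := by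
  constructor
  · rintro ⟨y, hy, rfl⟩
    exact ⟨y.2, hy⟩
  · rintro ⟨h, h'⟩
    exact ⟨⟨x, h⟩, h', rfl⟩

lemma cut_le (D V : Opens X) : cut D V ≤ V := fun _ h ↦ (mem_cut.1 h).2

lemma cut_mono (D : Opens X) {V W : Opens X} (h : W ≤ V) : cut D W ≤ cut D V :=
  fun _ hx ↦ mem_cut.2 ⟨(mem_cut.1 hx).1, h (mem_cut.1 hx).2⟩

/-- The functor sending `F` to the sheaf `V ↦ F(V ∩ D)`. -/
def secOn (D : Opens X) : TopCat.Sheaf AddCommGrpCat.{u} X ⥤ TopCat.Sheaf AddCommGrpCat.{u} X :=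
  restrictOpen D ⋙ TopCat.Sheaf.pushforward AddCommGrpCat.{u} D.inclusion'

instance (D : Opens X) : (secOn D).Additive :=
  inferInstanceAs (restrictOpen D ⋙ TopCat.Sheaf.pushforward AddCommGrpCat.{u} D.inclusion').Additive

/-- Restriction of sections to `V ∩ D`. -/
def toSecOn (D : Opens X) : 𝟭 (TopCat.Sheaf AddCommGrpCat.{u} X) ⟶ secOn D where
  app F := ⟨{ app V := F.obj.map (homOfLE (cut_le D V.unop)).op
              naturality V W i := by
                exact (F.obj.map_comp i _).symm.trans (F.obj.map_comp _
                  (homOfLE (cut_mono D i.unop.le)).op) }⟩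
  naturality F G φ := by
    apply CategoryTheory.Sheaf.hom_ext
    ext V : 2
    exact (φ.hom.naturality (homOfLE (cut_le D V.unop)).op).symm

variable (D : Opens X) {F G : TopCat.Sheaf AddCommGrpCat.{u} X}

/-- Sections of `secOn D` over `V` are by definition sections over `cut D V`, so injectivity is
inherited. -/
lemma mono_secOn_map {φ : F ⟶ G} [hφ : Mono φ] : Mono ((secOn D).map φ) := by
  rw [mono_iff_injective] at hφ ⊢
  exact fun V s hs ↦ hφ (cut D V) s hs

variable (F) in
/-- The short exact sequence `0 ⟶ F_D ⟶ I_D ⟶ I_D / F_D ⟶ 0`, where `I` is an injective sheaf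
containing `F`. -/
abbrev secOnShift : ShortComplex (TopCat.Sheaf AddCommGrpCat.{u} X) :=
  ShortComplex.mk ((secOn D).map (Injective.ι F))
    (Limits.cokernel.π ((secOn D).map (Injective.ι F))) (by simp)

variable (F) in
lemma secOnShift_shortExact : (secOnShift D F).ShortExact where
  exact := ShortComplex.exact_cokernel _
  mono_f := mono_secOn_map D
  epi_g := by dsimp; infer_instance

variable (F) in
/-- The comparison of `I_D / F_D` with `(I / F)_D`. -/
def secOnShiftDesc : (secOnShift D F).X₃ ⟶ (secOn D).obj (injectiveShift F).X₃ :=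
  Limits.cokernel.desc _ ((secOn D).map (injectiveShift F).g)
    (by rw [← Functor.map_comp]; erw [(injectiveShift F).zero]; simp)

variable (F) in
lemma π_secOnShiftDesc :
    (secOnShift D F).g ≫ secOnShiftDesc D F = (secOn D).map (injectiveShift F).g :=
  Limits.cokernel.π_desc _ _ _

-- A section of `I` over `W ∩ D` that vanishes in `I / F` comes from `F` over `W ∩ D`, by left
-- exactness of sections. Surjectivity, by contrast, requires `H¹` of `F` to vanish on a basis of
-- intersections with `D`.
variable (F) in
lemma mono_secOnShiftDesc : Mono (secOnShiftDesc D F) := by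
  rw [mono_iff_injective]
  intro V s hs
  refine sec_ext fun x hx ↦ ?_
  obtain ⟨W, h, t, hxW, ht⟩ :=
    (epi_iff_local _).1 (secOnShift_shortExact D F).epi_g V s x hx
  refine ⟨W, h, hxW, ?_⟩
  have h₁ : ap (injectiveShift F).g (cut D W) t = 0 := by
    have : ap (secOnShift D F).g W t = rs _ h s := ht
    have h₂ := congrArg (ap (secOnShiftDesc D F) W) this
    rw [← ap_comp, π_secOnShiftDesc, ← rs_ap, hs, map_zero] at h₂
    exact h₂
  obtain ⟨t', rfl⟩ := exists_sec_of_shortExact (injectiveShift_shortExact F) _ h₁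
  rw [← ht, map_zero]
  exact ap_comp_eq_zero (secOnShift D F).zero (show Sec ((secOn D).obj F) W from t')

variable (F) in
/-- The comparison of short exact sequences induced by restriction to `D`. -/
def secOnShiftMap : injectiveShift F ⟶ secOnShift D F where
  τ₁ := (toSecOn D).app F
  τ₂ := (toSecOn D).app (Injective.under F)
  τ₃ := Limits.cokernel.desc _ ((toSecOn D).app (Injective.under F) ≫ (secOnShift D F).g) (by
    have := (toSecOn D).naturality (Injective.ι F)
    dsimp at this ⊢
    rw [reassoc_of% this, Limits.cokernel.condition, Limits.comp_zero])
  comm₁₂ := ((toSecOn D).naturality (Injective.ι F)).symm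
  comm₂₃ := (Limits.cokernel.π_desc _ _ _).symm

variable (F) in
lemma τ₃_secOnShiftMap_desc :
    (secOnShiftMap D F).τ₃ ≫ secOnShiftDesc D F = (toSecOn D).app (injectiveShift F).X₃ := by
  have := (injectiveShift_shortExact F).epi_g
  rw [← cancel_epi (injectiveShift F).g, ← (secOnShiftMap D F).comm₂₃_assoc, π_secOnShiftDesc]
  exact ((toSecOn D).naturality (injectiveShift F).g).symm

variable (F) in
lemma map_δ_toSecOn {V : Opens X} {i : ℕ} (η : Coh (injectiveShift F).X₃ V i) :
    Coh.map V (i + 1) ((toSecOn D).app F) (Coh.δ (injectiveShift_shortExact F) V i η) =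
      Coh.δ (secOnShift_shortExact D F) V i (Coh.map V i (secOnShiftMap D F).τ₃ η) :=
  Coh.map_δ (injectiveShift_shortExact F) (secOnShift_shortExact D F) (secOnShiftMap D F) η

/-- If cohomology of `F` vanishes in degrees `1 ≤ q ≤ i` over intersections of `D` with basic open
subsets, then a class of degree `i + 1` vanishing on `W ∩ D` maps to zero in the cohomology of the
sheaf `V ↦ F(V ∩ D)`. -/
lemma Coh.map_toSecOn_eq_zero {B : Opens X → Prop}
    (hB : ∀ (V : Opens X), ∀ x ∈ V, ∃ W ≤ V, x ∈ W ∧ B W) (W : Opens X) (i : ℕ) :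
    ∀ (F : TopCat.Sheaf AddCommGrpCat.{u} X),
      (∀ q, q + 1 ≤ i → ∀ V, B V → ∀ ζ : Coh F (cut D V) (q + 1), ζ = 0) →
      ∀ ξ : Coh F W (i + 1), Coh.res F (i + 1) (cut_le D W) ξ = 0 →
        Coh.map W (i + 1) ((toSecOn D).app F) ξ = 0 := by
  induction i with
  | zero =>
    intro F _ ξ hξ
    obtain ⟨η, rfl⟩ := Coh.exists_δ_eq F ξ
    obtain ⟨q, rfl⟩ := (Coh.sec _ _).surjective η
    rw [map_δ_toSecOn]
    have h₁ := (Coh.res_δ (injectiveShift_shortExact F) (cut_le D W) _).symm.trans hξ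
    obtain ⟨t, ht⟩ := Coh.exact₃ (injectiveShift_shortExact F) _ h₁
    obtain ⟨t, rfl⟩ := (Coh.sec _ _).surjective t
    rw [Coh.map_sec, Coh.res_sec] at ht
    have ht := (Coh.sec _ _).injective ht
    -- The restriction of `q` to `W ∩ D` lifts to a section `t` of the injective sheaf. The two
    -- sides agree in `(I / F)_D`, into which `I_D / F_D` embeds.
    have : ap (secOnShiftMap D F).τ₃ W q =
        ap (secOnShift D F).g W (show Sec ((secOn D).obj (Injective.under F)) W from t) := by
      have := mono_secOnShiftDesc D F
      rw [mono_iff_injective] at this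
      rw [← sub_eq_zero]
      apply this
      rw [map_sub, sub_eq_zero, ← ap_comp, ← ap_comp, τ₃_secOnShiftMap_desc, π_secOnShiftDesc]
      exact ht.symm
    rw [Coh.map_sec, this, ← Coh.map_sec, Coh.δ_map]
  | succ i ih =>
    intro F hF ξ hξ
    obtain ⟨η, rfl⟩ := Coh.exists_δ_eq F ξ
    have hI : Injective (injectiveShift F).X₂ := inferInstanceAs (Injective (Injective.under F))
    -- The quotient `I / F` satisfies the hypotheses one degree lower, by the long exact sequence
    -- over the sets `cut D V`.
    have hη := ih (injectiveShift F).X₃ (fun q hq V hV ζ ↦ by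
      have h := Coh.exact₃ (injectiveShift_shortExact F) ζ (hF (q + 1) (by omega) V hV _)
      obtain ⟨θ, rfl⟩ := h
      rw [Coh.eq_zero_of_injective θ, map_zero]) η (by
        have h₁ := (Coh.res_δ (injectiveShift_shortExact F) (cut_le D W) _).symm.trans hξ
        obtain ⟨θ, hθ⟩ := Coh.exact₃ (injectiveShift_shortExact F) _ h₁
        rw [← hθ, Coh.eq_zero_of_injective θ, map_zero])
    have : Mono (secOnShiftDesc D F) := mono_secOnShiftDesc D F
    -- Vanishing of `H¹` of `F` over `D ∩ W` for basic `W` lifts sections of `I / F` to `I`. Hence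
    -- `I_D / F_D` is `(I / F)_D`, and the vanishing of the image of `η` can be read in the former.
    have : Epi (secOnShiftDesc D F) := by
      rw [epi_iff_local]
      intro V s x hx
      obtain ⟨W, hW, hxW, hBW⟩ := hB V x hx
      obtain ⟨t, ht⟩ := Coh.exact₃ (injectiveShift_shortExact F)
        (Coh.sec _ _ (rs (injectiveShift F).X₃ (cut_mono D hW) s)) (hF 0 (by omega) W hBW _)
      obtain ⟨t, rfl⟩ := (Coh.sec _ _).surjective t
      rw [Coh.map_sec] at ht
      have ht := (Coh.sec _ _).injective ht
      refine ⟨W, hW, ap (secOnShift D F).g W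
        (show Sec ((secOn D).obj (Injective.under F)) W from t), hxW, ?_⟩
      rw [← ap_comp, π_secOnShiftDesc]
      exact ht
    have : IsIso (secOnShiftDesc D F) := isIso_of_mono_of_epi _
    rw [map_δ_toSecOn]
    have e : Coh.map W (i + 1) (secOnShiftMap D F).τ₃ η = 0 := by
      rw [← τ₃_secOnShiftMap_desc, Coh.map_comp] at hη
      have := congrArg (Coh.map W (i + 1) (inv (secOnShiftDesc D F))) hη
      rwa [← Coh.map_comp, IsIso.hom_inv_id, Coh.map_id, map_zero] at this
    rw [e, map_zero]

/-- If `F(V) = F(V ∩ D)` for all `V` and the cohomology of `F` vanishes in degrees `1 ≤ q ≤ i` over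
intersections of `D` with basic open subsets, then a class of degree `i + 1` over `W` vanishes as
soon as its restriction to `W ∩ D` does. -/
lemma Coh.eq_zero_of_res_cut_eq_zero {B : Opens X → Prop}
    (hB : ∀ (V : Opens X), ∀ x ∈ V, ∃ W ≤ V, x ∈ W ∧ B W)
    [IsIso ((toSecOn D).app F)] {i : ℕ}
    (hi : ∀ q, q + 1 ≤ i → ∀ V, B V → ∀ ζ : Coh F (cut D V) (q + 1), ζ = 0) {W : Opens X}
    (ξ : Coh F W (i + 1)) (hξ : Coh.res F (i + 1) (cut_le D W) ξ = 0) : ξ = 0 := by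
  have h := congrArg (Coh.map W (i + 1) (inv ((toSecOn D).app F)))
    (Coh.map_toSecOn_eq_zero D hB W i F hi ξ hξ)
  rwa [← Coh.map_comp, IsIso.hom_inv_id, Coh.map_id, map_zero] at h

end Cut

/-! ### Morphisms that are bijective on sections over the open subsets of `W` -/

section Bijective

open Limits

lemma shortExact_kernel_image {A : Type*} [Category A] [Abelian A] {F G : A} (φ : F ⟶ G) :
    (ShortComplex.mk (kernel.ι φ) (Abelian.factorThruImage φ) (by
      rw [← cancel_mono (Abelian.image.ι φ)]; simp)).ShortExact where
  exact := by
    rw [ShortComplex.exact_iff_of_epi_of_isIso_of_mono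
      (S₁ := ShortComplex.mk (kernel.ι φ) (Abelian.factorThruImage φ) _)
      (S₂ := ShortComplex.mk (kernel.ι φ) φ (by simp))
      { τ₁ := 𝟙 _, τ₂ := 𝟙 _, τ₃ := Abelian.image.ι φ }]
    exact ShortComplex.exact_kernel φ

lemma shortExact_image_cokernel {A : Type*} [Category A] [Abelian A] {F G : A} (φ : F ⟶ G) :
    (ShortComplex.mk (Abelian.image.ι φ) (cokernel.π φ) (by simp)).ShortExact where
  exact := ShortComplex.exact_kernel _

variable {F G : TopCat.Sheaf AddCommGrpCat.{u} X}

lemma isFlasqueOn_of_eq_zero {W : Opens X} (h : ∀ V ≤ W, ∀ s : Sec F V, s = 0) :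
    IsFlasqueOn F W := fun V hV s ↦ ⟨0, by rw [h V hV s, map_zero]⟩

/-- A sheaf that is zero on `W` is flasque there. -/
lemma Coh.eq_zero_of_sec_eq_zero {W : Opens X} (h : ∀ V ≤ W, ∀ s : Sec F V, s = 0) {i : ℕ}
    (ξ : Coh F W i) : ξ = 0 := by
  cases i with
  | zero =>
    obtain ⟨s, rfl⟩ := (Coh.sec _ _).surjective ξ
    rw [h W le_rfl s, map_zero]
  | succ i => exact (isFlasqueOn_of_eq_zero h).coh_eq_zero ξ

variable {φ : F ⟶ G} {W : Opens X}

lemma sec_kernel_eq_zero (hφ : ∀ V ≤ W, Function.Bijective (ap φ V)) (V : Opens X) (hV : V ≤ W)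
    (s : Sec (kernel φ) V) : s = 0 := by
  apply (mono_iff_injective (kernel.ι φ)).1 inferInstance
  apply (hφ V hV).1
  rw [← ap_comp, kernel.condition, ap_zero, map_zero]

lemma sec_cokernel_eq_zero (hφ : ∀ V ≤ W, Function.Bijective (ap φ V)) (V : Opens X) (hV : V ≤ W)
    (s : Sec (cokernel φ) V) : s = 0 := by
  refine sec_ext fun x hx ↦ ?_
  obtain ⟨V', hV', t, hxV, ht⟩ := (epi_iff_local (cokernel.π φ)).1 inferInstance V s x hx
  obtain ⟨t, rfl⟩ := (hφ V' (hV'.trans hV)).2 t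
  refine ⟨V', hV', hxV, ?_⟩
  rw [← ht, ← ap_comp, cokernel.condition, ap_zero, map_zero]

/-- The kernel of `m` on cohomology comes from `C` one degree lower and the kernel of `p` from `K`
in the same degree; both vanish over `W`. -/
lemma Coh.eq_zero_of_map_comp_eq_zero {K I C : TopCat.Sheaf AddCommGrpCat.{u} X} {k : K ⟶ F}
    {p : F ⟶ I} {m : I ⟶ G} {c : G ⟶ C} {h₁ : k ≫ p = 0} {h₂ : m ≫ c = 0}
    (hS : (ShortComplex.mk k p h₁).ShortExact) (hT : (ShortComplex.mk m c h₂).ShortExact)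
    (hK : ∀ V ≤ W, ∀ s : Sec K V, s = 0) (hC : ∀ V ≤ W, ∀ s : Sec C V, s = 0) {i : ℕ}
    (ξ : Coh F W (i + 1)) (hξ : Coh.map W (i + 1) (p ≫ m) ξ = 0) : ξ = 0 := by
  rw [Coh.map_comp] at hξ
  obtain ⟨η, hη⟩ := Coh.exact₁ hT _ hξ
  have h : η = 0 := Coh.eq_zero_of_sec_eq_zero hC η
  have e : Coh.map W (i + 1) p ξ = 0 := by rw [← hη, h, map_zero]
  obtain ⟨η, rfl⟩ := Coh.exact₂ hS ξ e
  have h : η = 0 := Coh.eq_zero_of_sec_eq_zero hK η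
  rw [h, map_zero]

/-- A morphism of sheaves inducing bijections on sections over open subsets of `W` induces
injections on the cohomology over `W`. -/
lemma Coh.eq_zero_of_map_eq_zero (hφ : ∀ V ≤ W, Function.Bijective (ap φ V)) {i : ℕ}
    (ξ : Coh F W i) (hξ : Coh.map W i φ ξ = 0) : ξ = 0 := by
  cases i with
  | zero =>
    obtain ⟨s, rfl⟩ := (Coh.sec _ _).surjective ξ
    rw [Coh.map_sec, map_eq_zero_iff _ (Coh.sec _ _).injective,
      map_eq_zero_iff _ (hφ W le_rfl).1] at hξ
    rw [hξ, map_zero]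
  | succ i =>
    refine Coh.eq_zero_of_map_comp_eq_zero (shortExact_kernel_image φ)
      (shortExact_image_cokernel φ) (sec_kernel_eq_zero hφ) (sec_cokernel_eq_zero hφ) ξ ?_
    rwa [Abelian.image.fac]

end Bijective

end TopCat.Sheaf

end

/-! ### Dimension shifting along the cycles of an acyclic complex -/

noncomputable section

open CategoryTheory TopologicalSpace Opposite Abelian

/-- A cohomological functor with values in abelian groups: additive functors `H⁰, H¹, …` with `H⁰`
left exact, together with a long exact sequence for each short exact sequence. -/
structure CohomologicalFunctor (A : Type*) [Category A] [Abelian A] where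
  H (i : ℕ) : A ⥤ AddCommGrpCat.{u}
  additive (i : ℕ) : (H i).Additive
  eq_zero_of_map_f {S : ShortComplex A} (hS : S.ShortExact) (ξ : (H 0).obj S.X₁) :
    (H 0).map S.f ξ = 0 → ξ = 0
  δ {S : ShortComplex A} (hS : S.ShortExact) (i : ℕ) : (H i).obj S.X₃ →+ (H (i + 1)).obj S.X₁
  map_f_δ {S : ShortComplex A} (hS : S.ShortExact) (i : ℕ) (ξ : (H i).obj S.X₃) :
    (H (i + 1)).map S.f (δ hS i ξ) = 0
  δ_map_g {S : ShortComplex A} (hS : S.ShortExact) (i : ℕ) (ξ : (H i).obj S.X₂) :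
    δ hS i ((H i).map S.g ξ) = 0
  exact₁ {S : ShortComplex A} (hS : S.ShortExact) (i : ℕ) (ξ : (H (i + 1)).obj S.X₁) :
    (H (i + 1)).map S.f ξ = 0 → ∃ η, δ hS i η = ξ
  exact₂ {S : ShortComplex A} (hS : S.ShortExact) (i : ℕ) (ξ : (H i).obj S.X₂) :
    (H i).map S.g ξ = 0 → ∃ η, (H i).map S.f η = ξ
  exact₃ {S : ShortComplex A} (hS : S.ShortExact) (i : ℕ) (ξ : (H i).obj S.X₃) :
    δ hS i ξ = 0 → ∃ η, (H i).map S.g η = ξ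

namespace CohomologicalFunctor

variable {A : Type*} [Category A] [Abelian A] (T : CohomologicalFunctor.{u} A)

instance (i : ℕ) : (T.H i).Additive := T.additive i

lemma eq_zero_of_isZero {X : A} (hX : Limits.IsZero X) {i : ℕ} (ξ : (T.H i).obj X) : ξ = 0 :=
  (AddCommGrpCat.subsingleton_of_isZero ((T.H i).map_isZero hX)).elim _ _

lemma map_comp_apply {X Y Z : A} (f : X ⟶ Y) (g : Y ⟶ Z) {i : ℕ} (ξ : (T.H i).obj X) :
    (T.H i).map (f ≫ g) ξ = (T.H i).map g ((T.H i).map f ξ) := by simp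

lemma eq_zero_of_mono {X Y : A} (f : X ⟶ Y) [Mono f] (ξ : (T.H 0).obj X)
    (h : (T.H 0).map f ξ = 0) : ξ = 0 :=
  T.eq_zero_of_map_f (S := ShortComplex.mk f (Limits.cokernel.π f) (by simp))
    ⟨ShortComplex.exact_cokernel f⟩ ξ h

/-- The cokernel of `S.f` embeds into `S.X₃`, so no surjectivity of `S.g` is needed. -/
lemma exists_of_exact {S : ShortComplex A} (hS : S.Exact) [Mono S.f] (ξ : (T.H 0).obj S.X₂)
    (h : (T.H 0).map S.g ξ = 0) : ∃ η, (T.H 0).map S.f η = ξ := by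
  have hS' : (ShortComplex.mk S.f (Limits.cokernel.π S.f) (by simp)).ShortExact :=
    ⟨ShortComplex.exact_cokernel S.f⟩
  have : Mono (Limits.cokernel.desc S.f S.g S.zero) := hS.mono_cokernelDesc
  refine T.exact₂ hS' 0 ξ (T.eq_zero_of_mono (Limits.cokernel.desc S.f S.g S.zero) _ ?_)
  rw [← map_comp_apply]
  simpa using h

section Complex

variable (C : ChainComplex A ℕ)

lemma cyclesShortComplex_zero (q : ℕ) : C.iCycles (q + 1) ≫ C.toCycles (q + 1) q = 0 := by
  rw [← cancel_mono (C.iCycles q)]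
  simp

/-- The complex `Z_{q+1} ⟶ C_{q+1} ⟶ Z_q`. -/
abbrev cyclesShortComplex (q : ℕ) : ShortComplex A :=
  ShortComplex.mk (C.iCycles (q + 1)) (C.toCycles (q + 1) q) (cyclesShortComplex_zero C q)

variable {C}

lemma exact_iCycles (q : ℕ) :
    (ShortComplex.mk (C.iCycles (q + 1)) (C.d (q + 1) q) (by simp)).Exact :=
  ShortComplex.exact_of_f_is_kernel _ (C.cyclesIsKernel (q + 1) q (by simp))

lemma epi_toCycles {q : ℕ} (h : C.ExactAt q) : Epi (C.toCycles (q + 1) q) := by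
  have h₁ := (C.exactAt_iff_isZero_homology q).1 h
  have h₂ : (ShortComplex.mk (C.toCycles (q + 1) q) (C.homologyπ q) (by simp)).Exact :=
    ShortComplex.exact_of_g_is_cokernel _ (C.homologyIsCokernel (q + 1) q (by simp))
  exact h₂.epi_f (h₁.eq_of_tgt _ _)

lemma cyclesShortComplex_shortExact {q : ℕ} (h : C.ExactAt q) :
    (cyclesShortComplex C q).ShortExact where
  exact := by
    have h₁ := exact_iCycles (C := C) q
    rw [ShortComplex.exact_iff_of_epi_of_isIso_of_mono
      (S₁ := cyclesShortComplex C q)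
      (S₂ := ShortComplex.mk (C.iCycles (q + 1)) (C.d (q + 1) q) (by simp))
      { τ₁ := 𝟙 _, τ₂ := 𝟙 _, τ₃ := C.iCycles q }]
    exact h₁
  epi_g := epi_toCycles h

/-- By exactness `Z_q` is a quotient of `C_{q+1} = 0`. The case `q = n` expresses that the last
differential is a monomorphism. -/
lemma isZero_cycles {n q : ℕ} (hC : ∀ i, 0 < i → C.ExactAt i)
    (hn : ∀ i, n < i → Limits.IsZero (C.X i)) (hq : 1 ≤ q) (hnq : n ≤ q) :
    Limits.IsZero (C.cycles q) := by
  have := epi_toCycles (hC q hq)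
  exact (hn (q + 1) (by omega)).of_epi (C.toCycles (q + 1) q)

/-- By left exactness `s` comes from `H⁰(Z_{p+1})`. The obstruction to lifting it to `H⁰(C_{p+2})`
is its coboundary in `H¹(Z_{p+2})`, which dies in `H¹(C_{p+2})`. -/
lemma exact_of_cycles {p : ℕ} (h : C.ExactAt (p + 1))
    (hp : ∀ ξ : (T.H 1).obj (C.cycles (p + 2)), (T.H 1).map (C.iCycles (p + 2)) ξ = 0 → ξ = 0)
    (s : (T.H 0).obj (C.X (p + 1))) (hs : (T.H 0).map (C.d (p + 1) p) s = 0) :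
    ∃ t, (T.H 0).map (C.d (p + 2) (p + 1)) t = s := by
  obtain ⟨s, rfl⟩ := T.exists_of_exact (exact_iCycles (C := C) p) s hs
  obtain ⟨t, rfl⟩ := T.exact₃ (cyclesShortComplex_shortExact h) 0 s
    (hp _ (T.map_f_δ (cyclesShortComplex_shortExact h) 0 s))
  refine ⟨t, ?_⟩
  dsimp only
  rw [← map_comp_apply, C.toCycles_i]

/-- Converse of `exact_of_cycles`: a class dying in `H¹(C_{p+2})` is the coboundary of some `η` in
`H⁰(Z_{p+1})`, and exactness lifts `η` to `H⁰(C_{p+2})`. -/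
lemma cycles_of_exact {p : ℕ} (h : C.ExactAt (p + 1))
    (hp : ∀ s : (T.H 0).obj (C.X (p + 1)), (T.H 0).map (C.d (p + 1) p) s = 0 →
      ∃ t, (T.H 0).map (C.d (p + 2) (p + 1)) t = s)
    (ξ : (T.H 1).obj (C.cycles (p + 2))) (hξ : (T.H 1).map (C.iCycles (p + 2)) ξ = 0) : ξ = 0 := by
  obtain ⟨η, rfl⟩ := T.exact₁ (cyclesShortComplex_shortExact h) 0 ξ hξ
  obtain ⟨t, ht⟩ := hp ((T.H 0).map (C.iCycles (p + 1)) η) (by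
    rw [← map_comp_apply, C.iCycles_d]
    simp)
  have : (T.H 0).map (C.toCycles (p + 2) (p + 1)) t = η := by
    rw [← sub_eq_zero]
    apply T.eq_zero_of_mono (C.iCycles (p + 1))
    rw [map_sub, ← map_comp_apply, C.toCycles_i, ht, sub_self]
  rw [← this]
  exact T.δ_map_g (cyclesShortComplex_shortExact h) 0 t

variable {n : ℕ} (hC : ∀ i, 0 < i → C.ExactAt i) (hn : ∀ i, n < i → Limits.IsZero (C.X i))
include hC hn

/-- `H⁰` of an acyclic complex concentrated in degrees `≤ n` is exact in positive degrees
`p ≥ n - 1`. -/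
lemma exact_of_le {p : ℕ} (hp : n ≤ p + 2) (s : (T.H 0).obj (C.X (p + 1)))
    (hs : (T.H 0).map (C.d (p + 1) p) s = 0) :
    ∃ t, (T.H 0).map (C.d (p + 2) (p + 1)) t = s :=
  T.exact_of_cycles (hC _ (by omega))
    (fun ξ _ ↦ T.eq_zero_of_isZero (isZero_cycles hC hn (by omega) hp) ξ) s hs

/-- Descending induction on `q`, with `a` bounding `n - q`: `Hᵏ(Z_q)` lies between `Hᵏ(C_{q+1})` and
`Hᵏ⁺¹(Z_{q+1})`. The condition `k + 1 ≤ q` is stable under this shift and keeps `k` at most `n - 2`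
while `q < n`. -/
lemma cohomology_cycles_eq_zero
    (h : ∀ k m, 1 ≤ k → k + 2 ≤ n → ∀ ξ : (T.H k).obj (C.X m), ξ = 0) (a : ℕ) :
    ∀ k q, n ≤ q + a → 1 ≤ k → k + 1 ≤ q → ∀ ξ : (T.H k).obj (C.cycles q), ξ = 0 := by
  induction a with
  | zero =>
    intro k q hq hk hkq ξ
    exact T.eq_zero_of_isZero (isZero_cycles hC hn (by omega) (by omega)) ξ
  | succ a ih =>
    intro k q hq hk hkq ξ
    by_cases hnq : n ≤ q
    · exact T.eq_zero_of_isZero (isZero_cycles hC hn (by omega) hnq) ξ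
    · obtain ⟨η, rfl⟩ := T.exact₃ (cyclesShortComplex_shortExact (hC q (by omega))) k ξ
        (ih (k + 1) (q + 1) (by omega) (by omega) (by omega) _)
      rw [h k _ hk (by omega) η, map_zero]

/-- `H⁰` of an acyclic complex concentrated in degrees `≤ n` is exact in positive degrees if the
cohomology of its terms vanishes in degrees `1, …, n - 2`. -/
lemma exact_of_cohomology_eq_zero
    (h : ∀ k m, 1 ≤ k → k + 2 ≤ n → ∀ ξ : (T.H k).obj (C.X m), ξ = 0) {p : ℕ}
    (s : (T.H 0).obj (C.X (p + 1))) (hs : (T.H 0).map (C.d (p + 1) p) s = 0) :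
    ∃ t, (T.H 0).map (C.d (p + 2) (p + 1)) t = s :=
  T.exact_of_cycles (hC _ (by omega))
    (fun ξ _ ↦ T.cohomology_cycles_eq_zero hC hn h n 1 (p + 2) (by omega) le_rfl (by omega) ξ) s hs

/-- If `H⁰` of an acyclic complex concentrated in degrees `≤ n` is exact in positive degrees and
the cohomology of its terms vanishes in degrees `1, …, i - 1`, where `i ≤ n - 2`, then `Hⁱ` is
injective on the last differential. -/
lemma eq_zero_of_map_d_eq_zero
    (h₀ : ∀ p (s : (T.H 0).obj (C.X (p + 1))), (T.H 0).map (C.d (p + 1) p) s = 0 →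
      ∃ t, (T.H 0).map (C.d (p + 2) (p + 1)) t = s) {i : ℕ} (hi : 1 ≤ i) (hin : i + 2 ≤ n)
    (h : ∀ k m, 1 ≤ k → k < i → ∀ ξ : (T.H k).obj (C.X m), ξ = 0)
    (ξ : (T.H i).obj (C.X n)) (hξ : (T.H i).map (C.d n (n - 1)) ξ = 0) : ξ = 0 := by
  obtain ⟨i, rfl⟩ : ∃ k, i = k + 1 := ⟨i - 1, by omega⟩
  obtain ⟨m, rfl⟩ : ∃ m, n = m + 1 := ⟨n - 1, by omega⟩
  obtain ⟨p, hp⟩ : ∃ p, m = p + 1 + (i + 1) := ⟨m - i - 2, by omega⟩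
  -- Degree and index rise together: a class killed in `C` is a coboundary of a class on the
  -- previous cycles, one degree lower, and that class vanishes because the cohomology of `C` in its
  -- degree does. The starting index `p` is chosen so that `k = i` reaches `Z_{n-1}`.
  have key (k : ℕ) (hk : k + 1 ≤ i + 1) : ∀ ξ : (T.H (k + 1)).obj (C.cycles (p + 1 + (k + 1))),
      (T.H (k + 1)).map (C.iCycles (p + 1 + (k + 1))) ξ = 0 → ξ = 0 := by
    induction k with
    | zero => exact T.cycles_of_exact (hC _ (by omega)) (h₀ p)
    | succ k ih =>
      intro ξ hξ
      obtain ⟨η, rfl⟩ :=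
        T.exact₁ (cyclesShortComplex_shortExact (hC (p + 1 + (k + 1)) (by omega))) (k + 1) ξ hξ
      rw [ih (by omega) η (h _ _ (by omega) (by omega) _), map_zero]
  have key := key i le_rfl
  rw [← hp] at key
  -- The last differential factors as `C_n → Z_{n-1} → C_{n-1}`; the second map is handled by `key`,
  -- the first by `Z_n = 0`.
  have hS := cyclesShortComplex_shortExact (hC m (by omega))
  obtain ⟨η, rfl⟩ := T.exact₂ hS (i + 1) ξ (key _ (by
    dsimp only
    rw [← map_comp_apply, C.toCycles_i]
    exact hξ))
  rw [T.eq_zero_of_isZero (isZero_cycles hC hn (by omega) le_rfl) η, map_zero]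

end Complex

end CohomologicalFunctor

end

/-! ### Stalks of `V ↦ Hⁱ(f⁻¹ V, F)` as a cohomological functor -/

noncomputable section

open CategoryTheory TopologicalSpace Opposite Abelian

namespace TopCat.Sheaf

variable {X Y : TopCat.{u}} (f : X ⟶ Y)

/-- The presheaf `V ↦ Hⁱ(f⁻¹ V, F)`. -/
def cohPresheaf (i : ℕ) : TopCat.Sheaf AddCommGrpCat.{u} X ⥤ TopCat.Presheaf AddCommGrpCat.{u} Y where
  obj F :=
    { obj V := AddCommGrpCat.of (Coh F ((Opens.map f).obj V.unop) i)
      map h := AddCommGrpCat.ofHom (Coh.res F i ((Opens.map f).map h.unop).le)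
      map_id V := by
        ext ξ
        exact Coh.res_rfl ξ
      map_comp h h' := by
        ext ξ
        exact (Coh.res_res ((Opens.map f).map h.unop).le ((Opens.map f).map h'.unop).le ξ).symm }
  map φ :=
    { app V := AddCommGrpCat.ofHom (Coh.map _ i φ)
      naturality V W h := by
        ext ξ
        exact (Coh.res_map ((Opens.map f).map h.unop).le φ ξ).symm }
  map_id F := by
    ext V ξ
    exact Coh.map_id ξ
  map_comp φ ψ := by
    ext V ξ
    exact Coh.map_comp φ ψ ξ

/-- The connecting homomorphisms of the presheaves `V ↦ Hⁱ(f⁻¹ V, F)`. -/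
def cohPresheafδ {S : ShortComplex (TopCat.Sheaf AddCommGrpCat.{u} X)} (hS : S.ShortExact) (i : ℕ) :
    (cohPresheaf f i).obj S.X₃ ⟶ (cohPresheaf f (i + 1)).obj S.X₁ where
  app V := AddCommGrpCat.ofHom (Coh.δ hS _ i)
  naturality V W h := by
    ext ξ
    exact (Coh.res_δ hS ((Opens.map f).map h.unop).le ξ).symm

/-- The stalk at `y` of `V ↦ Hⁱ(f⁻¹ V, F)`. -/
def cohStalk (y : Y) (i : ℕ) : TopCat.Sheaf AddCommGrpCat.{u} X ⥤ AddCommGrpCat.{u} :=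
  cohPresheaf f i ⋙ TopCat.Presheaf.stalkFunctor AddCommGrpCat.{u} y

namespace cohStalk

variable {F G : TopCat.Sheaf AddCommGrpCat.{u} X} {V W : Opens Y} {y : Y} {i : ℕ}

variable (F i) in
/-- The germ at `y` of a cohomology class. -/
def germ (hy : y ∈ V) : Coh F ((Opens.map f).obj V) i →+ (cohStalk f y i).obj F :=
  (TopCat.Presheaf.germ ((cohPresheaf f i).obj F) V y hy).hom

lemma exists_germ (t : (cohStalk f y i).obj F) :
    ∃ (V : Opens Y) (hy : y ∈ V) (ξ : Coh F ((Opens.map f).obj V) i), germ f F i hy ξ = t :=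
  TopCat.Presheaf.exists_germ_eq ((cohPresheaf f i).obj F) t

lemma germ_res (h : W ≤ V) (hy : y ∈ W) (ξ : Coh F ((Opens.map f).obj V) i) :
    germ f F i hy (Coh.res F i ((Opens.map f).map (homOfLE h)).le ξ) = germ f F i (h hy) ξ := by
  have e := TopCat.Presheaf.germ_res ((cohPresheaf f i).obj F) (homOfLE h) y hy
  exact congrArg (fun φ ↦ φ.hom ξ) e

lemma exists_res_eq_zero (hy : y ∈ V) (ξ : Coh F ((Opens.map f).obj V) i)
    (hξ : germ f F i hy ξ = 0) : ∃ (W : Opens Y) (h : W ≤ V), y ∈ W ∧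
      Coh.res F i ((Opens.map f).map (homOfLE h)).le ξ = 0 := by
  obtain ⟨W, hW, h, h', e⟩ := TopCat.Presheaf.germ_eq ((cohPresheaf f i).obj F) y hy hy ξ
    (0 : Coh F ((Opens.map f).obj V) i) (hξ.trans (map_zero (germ f F i hy)).symm)
  exact ⟨W, h.le, hW, e.trans (map_zero (Coh.res F i ((Opens.map f).map h').le))⟩

lemma map_germ (φ : F ⟶ G) (hy : y ∈ V) (ξ : Coh F ((Opens.map f).obj V) i) :
    (cohStalk f y i).map φ (germ f F i hy ξ) = germ f G i hy (Coh.map _ i φ ξ) :=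
  TopCat.Presheaf.stalkFunctor_map_germ_apply V y hy ((cohPresheaf f i).map φ) ξ

/-- The connecting homomorphism on stalks. -/
def δ (y : Y) {S : ShortComplex (TopCat.Sheaf AddCommGrpCat.{u} X)} (hS : S.ShortExact) (i : ℕ) :
    (cohStalk f y i).obj S.X₃ →+ (cohStalk f y (i + 1)).obj S.X₁ :=
  ((TopCat.Presheaf.stalkFunctor AddCommGrpCat.{u} y).map (cohPresheafδ f hS i)).hom

lemma δ_germ {S : ShortComplex (TopCat.Sheaf AddCommGrpCat.{u} X)} (hS : S.ShortExact)
    (hy : y ∈ V) (ξ : Coh S.X₃ ((Opens.map f).obj V) i) :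
    δ f y hS i (germ f S.X₃ i hy ξ) = germ f S.X₁ (i + 1) hy (Coh.δ hS _ i ξ) :=
  TopCat.Presheaf.stalkFunctor_map_germ_apply V y hy (cohPresheafδ f hS i) ξ

end cohStalk

instance (y : Y) (i : ℕ) : (cohStalk f y i).Additive where
  map_add {F G φ ψ} := by
    ext t
    obtain ⟨V, hy, ξ, rfl⟩ := cohStalk.exists_germ f t
    rw [AddCommGrpCat.hom_add_apply]
    refine (cohStalk.map_germ f _ hy ξ).trans ?_
    rw [Coh.map_add, map_add]
    exact congrArg₂ (· + ·) (cohStalk.map_germ f φ hy ξ).symm (cohStalk.map_germ f ψ hy ξ).symm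

/-- The stalks at `y` of the presheaves `V ↦ Hⁱ(f⁻¹ V, F)` form a cohomological functor. -/
def cohStalkFunctor (y : Y) : CohomologicalFunctor (TopCat.Sheaf AddCommGrpCat.{u} X) where
  H := cohStalk f y
  additive _ := inferInstance
  eq_zero_of_map_f {S} hS t ht := by
    obtain ⟨V, hy, ξ, rfl⟩ := cohStalk.exists_germ f t
    rw [cohStalk.map_germ] at ht
    obtain ⟨W, h, hyW, e⟩ := cohStalk.exists_res_eq_zero f _ _ ht
    rw [Coh.res_map] at e
    rw [← cohStalk.germ_res f h hyW]
    obtain ⟨s, hs⟩ := (Coh.sec _ _).surjective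
      (Coh.res S.X₁ 0 ((Opens.map f).map (homOfLE h)).le ξ)
    rw [← hs, Coh.map_sec, map_eq_zero_iff _ (Coh.sec _ _).injective] at e
    rw [← hs, (mono_iff_injective S.f).1 hS.mono_f _ s e, map_zero, map_zero]
  δ hS i := cohStalk.δ f y hS i
  map_f_δ {S} hS i t := by
    obtain ⟨V, hy, ξ, rfl⟩ := cohStalk.exists_germ f t
    rw [cohStalk.δ_germ, cohStalk.map_germ, Coh.map_f_δ, map_zero]
  δ_map_g {S} hS i t := by
    obtain ⟨V, hy, ξ, rfl⟩ := cohStalk.exists_germ f t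
    rw [cohStalk.map_germ, cohStalk.δ_germ, Coh.δ_map, map_zero]
  exact₁ {S} hS i t ht := by
    obtain ⟨V, hy, ξ, rfl⟩ := cohStalk.exists_germ f t
    rw [cohStalk.map_germ] at ht
    obtain ⟨W, h, hyW, e⟩ := cohStalk.exists_res_eq_zero f _ _ ht
    rw [Coh.res_map] at e
    obtain ⟨η, hη⟩ := Coh.exact₁ hS _ e
    exact ⟨cohStalk.germ f _ i hyW η, by rw [cohStalk.δ_germ, hη, cohStalk.germ_res f h]⟩
  exact₂ {S} hS i t ht := by
    obtain ⟨V, hy, ξ, rfl⟩ := cohStalk.exists_germ f t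
    rw [cohStalk.map_germ] at ht
    obtain ⟨W, h, hyW, e⟩ := cohStalk.exists_res_eq_zero f _ _ ht
    rw [Coh.res_map] at e
    obtain ⟨η, hη⟩ := Coh.exact₂ hS _ e
    exact ⟨cohStalk.germ f _ i hyW η, by rw [cohStalk.map_germ, hη, cohStalk.germ_res f h]⟩
  exact₃ {S} hS i t ht := by
    obtain ⟨V, hy, ξ, rfl⟩ := cohStalk.exists_germ f t
    rw [cohStalk.δ_germ] at ht
    obtain ⟨W, h, hyW, e⟩ := cohStalk.exists_res_eq_zero f _ _ ht
    have e := (Coh.res_δ hS _ _).symm.trans e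
    obtain ⟨η, hη⟩ := Coh.exact₃ hS _ e
    exact ⟨cohStalk.germ f _ i hyW η, by rw [cohStalk.map_germ, hη, cohStalk.germ_res f h]⟩

/-- A higher direct image vanishes if and only if the stalks of the presheaf
`V ↦ Hⁱ(f⁻¹ V, F)` vanish. -/
lemma isZero_rightDerived_pushforward_iff_cohStalk (F : TopCat.Sheaf AddCommGrpCat.{u} X) (i : ℕ) :
    Limits.IsZero (((TopCat.Sheaf.pushforward AddCommGrpCat.{u} f).rightDerived (i + 1)).obj F) ↔
      ∀ (y : Y) (t : (cohStalk f y (i + 1)).obj F), t = 0 := by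
  rw [isZero_rightDerived_pushforward_iff]
  constructor
  · intro H y t
    obtain ⟨V, hy, ξ, rfl⟩ := cohStalk.exists_germ f t
    obtain ⟨W, h, hyW, e⟩ := H V ξ y hy
    rw [← cohStalk.germ_res f h hyW, e, map_zero]
  · intro H V ξ y hy
    exact cohStalk.exists_res_eq_zero f hy ξ (H y _)

/-- Exactness of a complex of direct images can be checked on the stalks of
`V ↦ H⁰(f⁻¹ V, F)`. -/
lemma exact_pushforward_iff_cohStalk (S : ShortComplex (TopCat.Sheaf AddCommGrpCat.{u} X)) :
    (S.map (TopCat.Sheaf.pushforward AddCommGrpCat.{u} f)).Exact ↔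
      ∀ (y : Y) (t : (cohStalk f y 0).obj S.X₂), (cohStalk f y 0).map S.g t = 0 →
        ∃ t', (cohStalk f y 0).map S.f t' = t := by
  have key : (S.map (TopCat.Sheaf.pushforward AddCommGrpCat.{u} f)).Exact ↔
      ∀ (V : Opens Y) (s : Sec S.X₂ ((Opens.map f).obj V)), ap S.g _ s = 0 → ∀ y ∈ V,
        ∃ (W : Opens Y) (h : W ≤ V) (t : Sec S.X₁ ((Opens.map f).obj W)), y ∈ W ∧
          ap S.f _ t = rs S.X₂ ((Opens.map f).map (homOfLE h)).le s := exact_iff_local _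
  rw [key]
  constructor
  · intro H y t ht
    obtain ⟨V, hy, ξ, rfl⟩ := cohStalk.exists_germ f t
    rw [cohStalk.map_germ] at ht
    obtain ⟨W, h, hyW, e⟩ := cohStalk.exists_res_eq_zero f _ _ ht
    obtain ⟨s, rfl⟩ := (Coh.sec _ _).surjective ξ
    rw [Coh.map_sec, Coh.res_sec, map_eq_zero_iff _ (Coh.sec _ _).injective, rs_ap] at e
    obtain ⟨W', h', t, hy', ht'⟩ := H W _ e y hyW
    refine ⟨cohStalk.germ f _ 0 hy' (Coh.sec _ _ t), ?_⟩
    rw [cohStalk.map_germ, Coh.map_sec, ht', rs_rs, ← Coh.res_sec]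
    exact cohStalk.germ_res f (h'.trans h) hy' _
  · intro H V s hs y hy
    obtain ⟨t, ht⟩ := H y (cohStalk.germ f _ 0 hy (Coh.sec _ _ s)) (by
      rw [cohStalk.map_germ, Coh.map_sec, hs, map_zero, map_zero])
    obtain ⟨W, hyW, ξ, rfl⟩ := cohStalk.exists_germ f t
    obtain ⟨t, rfl⟩ := (Coh.sec _ _).surjective ξ
    rw [cohStalk.map_germ, ← cohStalk.germ_res f (inf_le_left : V ⊓ W ≤ V) ⟨hy, hyW⟩,
      ← cohStalk.germ_res f (inf_le_right : V ⊓ W ≤ W) ⟨hy, hyW⟩, ← sub_eq_zero, ← map_sub] at ht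
    obtain ⟨W', h, hyW', e⟩ := cohStalk.exists_res_eq_zero f _ _ ht
    rw [map_sub, sub_eq_zero, Coh.res_res, Coh.res_res, Coh.map_sec, Coh.res_sec, Coh.res_sec,
      (Coh.sec _ _).injective.eq_iff] at e
    exact ⟨W', h.trans inf_le_left,
      rs _ ((Opens.map f).map (homOfLE (h.trans inf_le_right))).le t, hyW',
      (rs_ap _ _ _).symm.trans e⟩

end TopCat.Sheaf

end

/-! ### McCoy's theorem and injectivity on finite free modules -/

noncomputable section

open CategoryTheory

section McCoy

variable {R : Type*} [CommRing R] {H : Type*} [AddCommGroup H] [Module R H] {m n : Type*}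
  [Fintype n] [DecidableEq n]

/-- **McCoy's theorem** with coefficients in a module. -/
lemma Matrix.eq_zero_of_forall_minor_smul_eq_zero (A : Matrix m n R)
    (hA : ∀ v : n → H, (∀ i, ∑ j, A i j • v j = 0) → v = 0) (t : H)
    (ht : ∀ s : n → m, (A.submatrix s id).det • t = 0) : t = 0 := by
  -- Descending induction on the size `k` of the minors killing `t`; the empty minor, which is `1`,
  -- gives the result.
  have key (a : ℕ) : ∀ k, k + a = Fintype.card n → ∀ (r : Fin k → m) (c : Fin k → n),
      (A.submatrix r c).det • t = 0 := by
    induction a with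
    | zero =>
      intro k hk r c
      by_cases hc : Function.Injective c
      · let e : Fin k ≃ n := Equiv.ofBijective c
          ((Fintype.bijective_iff_injective_and_card c).2 ⟨hc, by simpa using hk⟩)
        have : A.submatrix r c = (A.submatrix (r ∘ e.symm) id).submatrix e e := by
          ext i j
          simp [e]
        rw [this, Matrix.det_submatrix_equiv_self]
        exact ht _
      · obtain ⟨i, j, hij, hne⟩ : ∃ i j, c i = c j ∧ i ≠ j := by
          simpa [Function.Injective] using hc
        rw [Matrix.det_zero_of_column_eq hne (by simp [hij]), zero_smul]
    | succ a ih =>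
      intro k hk r c
      obtain ⟨j₀, hj₀⟩ : ∃ j₀, ∀ l, c l ≠ j₀ := by
        by_contra! h
        have := Fintype.card_le_of_surjective c h
        simp at this
        omega
      let c' : Fin (k + 1) → n := Fin.cons j₀ c
      -- The vector of signed cofactors times `t`. Row `i` of `A` pairs with it to a minor of size
      -- `k + 1` times `t`, expanded along its first row, which is zero by induction. The coordinate
      -- `j₀` of `v` is the given minor times `t`, because `j₀` is not among the columns `c`.
      let v : n → H := ∑ l, Pi.single (c' l)
        (((-1) ^ (l : ℕ) * (A.submatrix r (c' ∘ l.succAbove)).det) • t)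
      have hv : v = 0 := by
        refine hA v fun i ↦ ?_
        have h := ih (k + 1) (by omega) (Fin.cons i r) c'
        rw [Matrix.det_succ_row_zero, Finset.sum_smul] at h
        simp only [v, Finset.sum_apply, Finset.smul_sum]
        rw [Finset.sum_comm, ← h]
        refine Finset.sum_congr rfl fun l _ ↦ ?_
        rw [Finset.sum_eq_single (c' l) (fun j _ hj ↦ by simp [hj]) (by simp), Pi.single_eq_same,
          smul_smul]
        congr 1
        simp only [Matrix.submatrix_apply, Fin.cons_zero, Matrix.submatrix_submatrix]
        have : (Fin.cons i r : Fin (k + 1) → m) ∘ Fin.succ = r := rfl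
        rw [this]
        ring
      have h₀ := congrFun hv j₀
      simp only [v, Finset.sum_apply, Pi.zero_apply] at h₀
      rw [Fin.sum_univ_succ, Finset.sum_eq_zero (fun l _ ↦ by
        rw [Pi.single_eq_of_ne]; simpa [c'] using (hj₀ l).symm), add_zero] at h₀
      have e : c' ∘ Fin.succAbove 0 = c := rfl
      simpa [c', e, Pi.single_eq_same] using h₀
  simpa using key (Fintype.card n) 0 (by simp) Fin.elim0 Fin.elim0

end McCoy

variable {R : Type u} [CommRing R] (E : ModuleCat.{u} R ⥤ AddCommGrpCat.{u}) [E.Additive]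

/-- The action of `R` on the values of an additive functor of `R`-modules. -/
abbrev functorModule (P : ModuleCat.{u} R) : Module R (E.obj P) where
  smul r t := E.map (r • 𝟙 P) t
  one_smul t := by
    change E.map ((1 : R) • 𝟙 P) t = t
    rw [one_smul]
    simp
  mul_smul r s t := by
    change E.map ((r * s) • 𝟙 P) t = E.map (r • 𝟙 P) (E.map (s • 𝟙 P) t)
    rw [show (r * s) • 𝟙 P = (s • 𝟙 P) ≫ (r • 𝟙 P) by simp [smul_smul],
      E.map_comp, ConcreteCategory.comp_apply]
  smul_zero r := map_zero _
  smul_add r := map_add _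
  add_smul r s t := by
    change E.map ((r + s) • 𝟙 P) t = E.map (r • 𝟙 P) t + E.map (s • 𝟙 P) t
    rw [add_smul, E.map_add]
    rfl
  zero_smul t := by
    change E.map ((0 : R) • 𝟙 P) t = 0
    rw [zero_smul, E.map_zero]
    rfl

/-- In bases, additivity turns `E.map φ` into the matrix of `φ` acting on tuples of elements of the
`R`-module `E(R)`, so McCoy's theorem applies with coefficients in `E(R)`. -/
lemma eq_zero_of_forall_minor {M N : ModuleCat.{u} R} [Module.Free R M] [Module.Finite R M]
    [Module.Free R N] [Module.Finite R N] (φ : M ⟶ N) (hφ : ∀ t, E.map φ t = 0 → t = 0)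
    (t : E.obj (ModuleCat.of R R))
    (ht : ∀ f ∈ idealOfMaximalMinors φ.hom, E.map (f • 𝟙 _) t = 0) : t = 0 := by
  classical
  let := functorModule E (ModuleCat.of R R)
  let b := Module.Free.chooseBasis R M
  let c := Module.Free.chooseBasis R N
  let A := LinearMap.toMatrix b c φ.hom
  let ι (j) : ModuleCat.of R R ⟶ M := ModuleCat.ofHom (LinearMap.toSpanSingleton R M (b j))
  let ι' (i) : ModuleCat.of R R ⟶ N := ModuleCat.ofHom (LinearMap.toSpanSingleton R N (c i))
  let π (j) : M ⟶ ModuleCat.of R R := ModuleCat.ofHom (b.coord j)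
  let π' (i) : N ⟶ ModuleCat.of R R := ModuleCat.ofHom (c.coord i)
  have hA (i j) : ι j ≫ φ ≫ π' i = A i j • 𝟙 (ModuleCat.of R R) := by
    ext
    simp [ι, π', A, LinearMap.toMatrix_apply]
  have hι (j k) : ι j ≫ π k = if j = k then 𝟙 _ else 0 := by
    ext
    by_cases h : j = k <;> simp [ι, π, h]
  have hN : 𝟙 N = ∑ i, π' i ≫ ι' i := by
    ext x
    simp [ι', π', ModuleCat.hom_sum, c.sum_repr]
  refine Matrix.eq_zero_of_forall_minor_smul_eq_zero A (fun v hv ↦ ?_) t (fun s ↦ ht _ ?_)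
  · have h : ∑ j, E.map (ι j) (v j) = 0 := by
      apply hφ
      have : E.map φ (∑ j, E.map (ι j) (v j)) =
          E.map (∑ i, π' i ≫ ι' i) (E.map φ (∑ j, E.map (ι j) (v j))) := by
        rw [← hN]
        simp
      let ev : (E.obj N ⟶ E.obj N) →+ E.obj N :=
        AddMonoidHom.mk' (fun ψ ↦ ψ (E.map φ (∑ j, E.map (ι j) (v j)))) fun _ _ ↦ rfl
      rw [this, E.map_sum]
      refine (map_sum ev _ _).trans (Finset.sum_eq_zero fun i _ ↦ ?_)
      have : E.map (π' i) (E.map φ (∑ j, E.map (ι j) (v j))) = 0 := by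
        rw [← hv i, map_sum, map_sum]
        refine Finset.sum_congr rfl fun j _ ↦ ?_
        change _ = E.map (A i j • 𝟙 _) (v j)
        rw [← hA]
        simp
      change E.map (π' i ≫ ι' i) _ = 0
      rw [E.map_comp, ConcreteCategory.comp_apply, this, map_zero]
    funext k
    have h' := congrArg (E.map (π k)) h
    rw [map_sum, Finset.sum_eq_single k (fun j _ hj ↦ ?_) (by simp), map_zero] at h'
    · rw [← ConcreteCategory.comp_apply, ← E.map_comp, hι, if_pos rfl] at h'
      simpa using h'
    · rw [← ConcreteCategory.comp_apply, ← E.map_comp, hι, if_neg hj]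
      simp
  · rw [idealOfMaximalMinors]
    apply Ideal.subset_span
    refine ⟨s, ?_⟩
    congr!

/-- If an additive functor is injective on a map of finite free modules, then an element of its
value at `R` vanishes if it is killed by a power of each maximal minor. -/
lemma eq_zero_of_forall_minor_pow {M N : ModuleCat.{u} R} [Module.Free R M] [Module.Finite R M]
    [Module.Free R N] [Module.Finite R N] (φ : M ⟶ N) (hφ : ∀ t, E.map φ t = 0 → t = 0)
    (t : E.obj (ModuleCat.of R R))
    (ht : ∀ f ∈ idealOfMaximalMinors φ.hom, ∃ k, E.map (f ^ k • 𝟙 _) t = 0) : t = 0 := by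
  let := functorModule E (ModuleCat.of R R)
  have hfg : (idealOfMaximalMinors φ.hom).FG := by
    rw [idealOfMaximalMinors]
    classical
    exact ⟨(Set.finite_range _).toFinset, by rw [Set.Finite.coe_toFinset]⟩
  -- The ideal of minors is finitely generated and lies in the radical of the annihilator of `t`, so
  -- one of its powers kills `t`; that power is then lowered one step at a time.
  obtain ⟨k, hk⟩ := Ideal.exists_pow_le_of_le_radical_of_fg
    (J := Submodule.annihilator (Submodule.span R {t})) (fun f hf ↦ by
      obtain ⟨k, hk⟩ := ht f hf
      exact ⟨k, (Submodule.mem_annihilator_span_singleton _ _).2 hk⟩) hfg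
  have key (k : ℕ) : ∀ t : E.obj (ModuleCat.of R R),
      (∀ f ∈ idealOfMaximalMinors φ.hom ^ k, f • t = 0) → t = 0 := by
    induction k with
    | zero =>
      intro t h
      simpa using h 1 (by simp)
    | succ k ih =>
      intro t h
      refine ih t fun f hf ↦ eq_zero_of_forall_minor E φ hφ _ fun g hg ↦ ?_
      change g • f • t = 0
      rw [smul_smul]
      exact h _ (by rw [pow_succ']; exact Ideal.mul_mem_mul hg hf)
  exact key k t fun f hf ↦ (Submodule.mem_annihilator_span_singleton _ _).1 (hk hf)

end

/-! ### Cohomology of quasi-coherent sheaves is torsion away from `D f` -/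

noncomputable section

open CategoryTheory TopologicalSpace Opposite Abelian
open TopCat.Sheaf

/-- An abstract version of the restriction to an open subscheme `X` of `Spec R` of the quasi-coherent
sheaves associated with `R`-modules. Here `D f` is the trace on `X` of the basic open subset of
`Spec R` defined by `f`, and `f` is *good* if this basic open subset is contained in `X`. -/
structure AssociatedSheaves (R : Type u) [CommRing R] (X : TopCat.{u}) where
  Φ : ModuleCat.{u} R ⥤ TopCat.Sheaf AddCommGrpCat.{u} X
  additive : Φ.Additive
  D : R → Opens X
  Good : R → Prop
  D_mul (f g : R) : D (f * g) = D f ⊓ D g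
  good_mul (f : R) {g : R} : Good g → Good (f * g)
  exists_good (V : Opens X) (x : X) : x ∈ V → ∃ g, Good g ∧ x ∈ D g ∧ D g ≤ V
  isCompact {g : R} : Good g → IsCompact (D g : Set X)
  τ (M : ModuleCat.{u} R) (V : Opens X) : M →+ Sec (Φ.obj M) V
  rs_τ {M : ModuleCat.{u} R} {V W : Opens X} (h : W ≤ V) (m : M) : rs _ h (τ M V m) = τ M W m
  ap_τ {M N : ModuleCat.{u} R} (φ : M ⟶ N) (V : Opens X) (m : M) :
    ap (Φ.map φ) V (τ M V m) = τ N V (φ m)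
  exists_τ {g : R} (hg : Good g) {M : ModuleCat.{u} R} (s : Sec (Φ.obj M) (D g)) :
    ∃ (n : ℕ) (m : M), ap (Φ.map (g ^ n • 𝟙 M)) _ s = τ M _ m
  exists_pow_smul {g : R} (hg : Good g) {M : ModuleCat.{u} R} (m : M) :
    τ M (D g) m = 0 → ∃ n : ℕ, g ^ n • m = 0
  bijective (M : ModuleCat.{u} R) {g : R} {V : Opens X} : V ≤ D g →
    Function.Bijective (ap (Φ.map (g • 𝟙 M)) V)

namespace AssociatedSheaves

variable {R : Type u} [CommRing R] {X : TopCat.{u}} (T : AssociatedSheaves R X)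

instance : T.Φ.Additive := T.additive

/-- Multiplication by an element of `R`. -/
abbrev mul (r : R) (M : ModuleCat.{u} R) : T.Φ.obj M ⟶ T.Φ.obj M := T.Φ.map (r • 𝟙 M)

variable {M N : ModuleCat.{u} R} {V W : Opens X}

lemma mul_mul (r s : R) : T.mul (r * s) M = T.mul r M ≫ T.mul s M := by
  rw [mul, mul, mul, ← Functor.map_comp]
  congr 1
  simp [smul_smul, mul_comm]

lemma mul_mul' (r s : R) : T.mul (r * s) M = T.mul s M ≫ T.mul r M := by
  rw [mul_comm, mul_mul]

lemma mul_one : T.mul 1 M = 𝟙 _ := by simp [mul]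

lemma mul_map (r : R) (φ : M ⟶ N) : T.mul r M ≫ T.Φ.map φ = T.Φ.map φ ≫ T.mul r N := by
  rw [mul, mul, ← Functor.map_comp, ← Functor.map_comp]
  simp

lemma ap_mul_ap_mul (r s : R) (t : Sec (T.Φ.obj M) V) :
    ap (T.mul r M) V (ap (T.mul s M) V t) = ap (T.mul (r * s) M) V t := by
  rw [mul_mul', ap_comp]

lemma ap_mul_map (r : R) (φ : M ⟶ N) (t : Sec (T.Φ.obj M) V) :
    ap (T.mul r N) V (ap (T.Φ.map φ) V t) = ap (T.Φ.map φ) V (ap (T.mul r M) V t) := by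
  rw [← ap_comp, ← mul_map, ap_comp]

lemma ap_mul_τ (r : R) (m : M) : ap (T.mul r M) V (T.τ M V m) = T.τ M V (r • m) := by
  rw [T.ap_τ]
  rfl

lemma ap_mul_pow_eq_zero_of_le {r : R} {k l : ℕ} (hkl : k ≤ l) {t : Sec (T.Φ.obj M) V}
    (h : ap (T.mul (r ^ k) M) V t = 0) : ap (T.mul (r ^ l) M) V t = 0 := by
  obtain ⟨d, rfl⟩ := Nat.exists_eq_add_of_le' hkl
  rw [pow_add, ← ap_mul_ap_mul, h, map_zero]

lemma bijective_pow (M : ModuleCat.{u} R) {g : R} (k : ℕ) {V : Opens X} (h : V ≤ T.D g) :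
    Function.Bijective (ap (T.mul (g ^ k) M) V) := by
  induction k with
  | zero =>
    rw [pow_zero, mul_one]
    exact Function.bijective_id
  | succ k ih =>
    rw [pow_succ, mul_mul]
    exact (T.bijective M h).comp ih

lemma eq_zero_of_pow {g : R} {k : ℕ} {V : Opens X} (h : V ≤ T.D g) {t : Sec (T.Φ.obj M) V}
    (ht : ap (T.mul (g ^ k) M) V t = 0) : t = 0 :=
  (T.bijective_pow M k h).1 (ht.trans (map_zero _).symm)

lemma sec_eq_zero {s : Sec (T.Φ.obj M) V}
    (h : ∀ x ∈ V, ∃ (g : R) (_ : x ∈ T.D g) (hV : T.D g ≤ V), rs _ hV s = 0) : s = 0 := by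
  refine sec_ext fun x hx ↦ ?_
  obtain ⟨g, hxg, hV, e⟩ := h x hx
  exact ⟨_, hV, hxg, by rw [e, map_zero]⟩

/-- The sheaf associated with a module all of whose elements are locally killed by powers of good
elements has no nonzero sections. -/
lemma sec_eq_zero_of_forall_exists {W : Opens X}
    (hM : ∀ m : M, ∀ x ∈ W, ∃ (g : R) (k : ℕ), x ∈ T.D g ∧ g ^ k • m = 0)
    (V : Opens X) (hV : V ≤ W) (s : Sec (T.Φ.obj M) V) : s = 0 := by
  refine sec_ext fun x hx ↦ ?_
  obtain ⟨h, hh, hxh, hhV⟩ := T.exists_good V x hx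
  obtain ⟨n, m, e⟩ := T.exists_τ hh (rs _ hhV s)
  obtain ⟨g, k, hxg, hg⟩ := hM m x (hV hx)
  refine ⟨T.D (g * h), by rw [T.D_mul]; exact inf_le_right.trans hhV,
    by rw [T.D_mul]; exact ⟨hxg, hxh⟩, ?_⟩
  have h₁ : T.D (g * h) ≤ T.D g := by rw [T.D_mul]; exact inf_le_left
  have h₂ : T.D (g * h) ≤ T.D h := by rw [T.D_mul]; exact inf_le_right
  rw [map_zero]
  apply T.eq_zero_of_pow (k := n) h₂
  apply T.eq_zero_of_pow (k := k) h₁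
  rw [← rs_rs hhV h₂, ← rs_ap, e, T.rs_τ, T.ap_mul_τ, hg, map_zero]

/-- On a good `D r` denominators can be cleared: `r ^ n` times `s` comes from some `m`, a further
power `r ^ k` makes `g` kill it, and the resulting element lifts along `f`. Dividing by `r ^ (k +
n)` is possible on `D r`. -/
lemma exists_local_lift {P : ModuleCat.{u} R} {f : M ⟶ N} {g : N ⟶ P}
    (hfg : ∀ n, g n = 0 → ∃ m, f m = n) (s : Sec (T.Φ.obj N) V)
    (hs : ap (T.Φ.map g) V s = 0) {x : X} (hx : x ∈ V) :
    ∃ (W : Opens X) (h : W ≤ V) (t : Sec (T.Φ.obj M) W), x ∈ W ∧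
      ap (T.Φ.map f) W t = rs (T.Φ.obj N) h s := by
  obtain ⟨r, hr, hxr, hrV⟩ := T.exists_good V x hx
  obtain ⟨n, m, e⟩ := T.exists_τ hr (rs _ hrV s)
  obtain ⟨k, hk⟩ := T.exists_pow_smul hr (g m) (by
    rw [← T.ap_τ, ← e, ← T.ap_mul_map, ← rs_ap, hs, map_zero, map_zero])
  obtain ⟨m', hm'⟩ := hfg (r ^ k • m) ((map_smul g.hom _ _).trans hk)
  obtain ⟨t, ht⟩ := (T.bijective_pow M (k + n) (le_refl (T.D r))).2 (T.τ M (T.D r) m')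
  refine ⟨T.D r, hrV, t, hxr, ?_⟩
  apply (T.bijective_pow N (k + n) (le_refl (T.D r))).1
  rw [T.ap_mul_map, ht, T.ap_τ, hm', pow_add, ← T.ap_mul_ap_mul, e, T.ap_mul_τ]

/-- The functor `Φ` is exact. -/
lemma shortExact_map {S : ShortComplex (ModuleCat.{u} R)} (hS : S.ShortExact) :
    (S.map T.Φ).ShortExact where
  exact := by
    rw [exact_iff_local]
    exact fun V s hs x hx ↦
      T.exists_local_lift ((ShortComplex.moduleCat_exact_iff S).1 hS.exact) s hs hx
  mono_f := by
    have hf : Function.Injective S.f := (ModuleCat.mono_iff_injective S.f).1 hS.mono_f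
    refine (TopCat.Sheaf.mono_iff_injective (T.Φ.map S.f)).2 fun V s hs ↦ sec_ext fun x hx ↦ ?_
    -- Injectivity is exactness with a zero map on the left, and surjectivity below is exactness
    -- with a zero map on the right.
    obtain ⟨W, h, t, hxW, e⟩ := T.exists_local_lift (f := (0 : S.X₁ ⟶ S.X₁)) (g := S.f)
      (fun n hn ↦ ⟨0, by rw [map_zero]; exact (hf (hn.trans (map_zero _).symm)).symm⟩) s hs hx
    exact ⟨W, h, hxW, by rw [← e, Functor.map_zero, ap_zero, map_zero]⟩
  epi_g := by
    have hf : Function.Surjective S.g := (ModuleCat.epi_iff_surjective S.g).1 hS.epi_g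
    exact (epi_iff_local (T.Φ.map S.g)).2 fun V s x hx ↦
      T.exists_local_lift (f := S.g) (g := (0 : S.X₃ ⟶ S.X₃)) (fun n _ ↦ hf n) s
        (by rw [Functor.map_zero, ap_zero]) hx

lemma exists_finset_cover (hW : IsCompact (W : Set X)) {P : R → Prop}
    (hP : ∀ x ∈ W, ∃ g, x ∈ T.D g ∧ P g) :
    ∃ t : Finset R, (∀ g ∈ t, P g) ∧ ∀ x ∈ W, ∃ g ∈ t, x ∈ T.D g := by
  choose! g hg using hP
  obtain ⟨t, ht, htW⟩ := hW.elim_nhds_subcover (fun x ↦ (T.D (g x) : Set X))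
    fun x hx ↦ (T.D (g x)).isOpen.mem_nhds (hg x hx).1
  classical
  refine ⟨t.image g, fun r hr ↦ ?_, fun x hx ↦ ?_⟩
  · obtain ⟨x, hx, rfl⟩ := Finset.mem_image.1 hr
    exact (hg x (ht x hx)).2
  · obtain ⟨y, hy, hxy⟩ := Set.mem_iUnion₂.1 (htW hx)
    exact ⟨g y, Finset.mem_image_of_mem g hy, hxy⟩

/-- A section over a quasi-compact open subset which vanishes where `f` is invertible is killed by
a power of `f`. -/
lemma exists_pow_mul_sec_eq_zero (hW : IsCompact (W : Set X)) (f : R) (s : Sec (T.Φ.obj M) W)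
    (hs : ∀ (V : Opens X) (hV : V ≤ W), V ≤ T.D f → rs _ hV s = 0) :
    ∃ k : ℕ, ap (T.mul (f ^ k) M) W s = 0 := by
  obtain ⟨t, ht, htW⟩ := T.exists_finset_cover hW
    (P := fun g ↦ ∃ (k : ℕ) (hg : T.D g ≤ W), rs _ hg (ap (T.mul (f ^ k) M) W s) = 0)
    (fun x hx ↦ by
      obtain ⟨g, hg, hxg, hgW⟩ := T.exists_good W x hx
      refine ⟨g, hxg, ?_⟩
      obtain ⟨n, m, e⟩ := T.exists_τ hg (rs _ hgW s)
      have h₁ : T.D (f * g) ≤ T.D f := by rw [T.D_mul]; exact inf_le_left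
      have h₂ : T.D (f * g) ≤ T.D g := by rw [T.D_mul]; exact inf_le_right
      obtain ⟨k, hk⟩ := T.exists_pow_smul (T.good_mul f hg) m (by
        rw [← T.rs_τ h₂, ← e, rs_ap, rs_rs, hs _ _ h₁, map_zero])
      refine ⟨k, hgW, ?_⟩
      -- On `D g` the factors `g ^ n` and `g ^ k` can be cancelled, so it suffices that `(f * g) ^
      -- k` kills the element `m` representing `g ^ n` times the section.
      apply T.eq_zero_of_pow (k := n) (le_refl (T.D g))
      apply T.eq_zero_of_pow (k := k) (le_refl (T.D g))
      rw [rs_ap, T.ap_mul_ap_mul, T.ap_mul_ap_mul, mul_assoc, mul_comm (g ^ n), ← mul_assoc,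
        ← T.ap_mul_ap_mul, e, T.ap_mul_τ, ← mul_pow, mul_comm g, hk, map_zero])
  choose! k hk using ht
  refine ⟨t.sup k, T.sec_eq_zero fun x hx ↦ ?_⟩
  obtain ⟨g, hg, hxg⟩ := htW x hx
  obtain ⟨hgW, e⟩ := hk g hg
  refine ⟨g, hxg, hgW, ?_⟩
  rw [rs_ap] at e ⊢
  exact T.ap_mul_pow_eq_zero_of_le (Finset.le_sup hg) e

section Bijective

variable {g : R} (hM : Function.Bijective fun m : M ↦ g • m)
include hM

lemma bijective_pow_of_bijective (k : ℕ) (V : Opens X) :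
    Function.Bijective (ap (T.mul (g ^ k) M) V) := by
  have : IsIso (g • 𝟙 M) := (ConcreteCategory.isIso_iff_bijective _).2 hM
  have hg : Function.Bijective (ap (T.mul g M) V) := by
    have : IsIso (T.mul g M) := inferInstanceAs (IsIso (T.Φ.map (g • 𝟙 M)))
    refine Function.bijective_iff_has_inverse.2 ⟨ap (inv (T.mul g M)) V, fun s ↦ ?_, fun s ↦ ?_⟩
    · rw [← ap_comp, IsIso.hom_inv_id, ap_id]
    · rw [← ap_comp, IsIso.inv_hom_id, ap_id]
  induction k with
  | zero =>
    rw [pow_zero, mul_one]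
    exact Function.bijective_id
  | succ k ih =>
    rw [pow_succ, mul_mul]
    exact hg.comp ih

lemma exists_pow_smul_eq (k : ℕ) (m : M) : ∃ m' : M, g ^ k • m' = m := by
  induction k generalizing m with
  | zero => exact ⟨m, by simp⟩
  | succ k ih =>
    obtain ⟨m, rfl⟩ := hM.2 m
    obtain ⟨m, rfl⟩ := ih m
    exact ⟨m, by rw [pow_succ', mul_smul]⟩

/-- Over `D (g * h)` the section `t` is `m` divided by `(g * h) ^ n`. The division by `g ^ n` takes
place in `M`, leaving only the denominator `h ^ n`, which makes sense on all of `D h`. -/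
lemma exists_local_extension (t : Sec (T.Φ.obj M) (cut (T.D g) V)) {x : X}
    (hx : x ∈ V) : ∃ (W : Opens X) (h : W ≤ V) (t' : Sec (T.Φ.obj M) W), x ∈ W ∧
      rs _ (cut_le (T.D g) W) t' = rs _ (cut_mono (T.D g) h) t := by
  obtain ⟨h, hh, hxh, hhV⟩ := T.exists_good V x hx
  have h₁ : T.D (g * h) ≤ cut (T.D g) V := fun y hy ↦ by
    rw [T.D_mul] at hy
    exact mem_cut.2 ⟨hy.1, hhV hy.2⟩
  have h₂ : cut (T.D g) (T.D h) ≤ T.D (g * h) := fun y hy ↦ by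
    rw [T.D_mul]
    exact mem_cut.1 hy
  obtain ⟨n, m, e⟩ := T.exists_τ (T.good_mul g hh) (rs (T.Φ.obj M) h₁ t)
  obtain ⟨m', hm'⟩ := exists_pow_smul_eq hM n m
  obtain ⟨t', ht'⟩ := (T.bijective_pow M n (le_refl (T.D h))).2 (T.τ M (T.D h) m')
  refine ⟨T.D h, hhV, t', hxh, ?_⟩
  apply (T.bijective_pow M n h₂).1
  rw [← rs_rs h₁ h₂, ← rs_ap, ← rs_ap, e, T.rs_τ, mul_pow, ← T.ap_mul_ap_mul, ht', T.ap_mul_τ,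
    hm', T.rs_τ]

/-- Over a quasi-compact `D h` such a section is killed by a power of `g`, which acts bijectively.
-/
lemma sec_eq_zero_of_rs_cut_eq_zero (s : Sec (T.Φ.obj M) V)
    (hs : rs _ (cut_le (T.D g) V) s = 0) : s = 0 := by
  refine T.sec_eq_zero fun x hx ↦ ?_
  obtain ⟨h, hh, hxh, hhV⟩ := T.exists_good V x hx
  refine ⟨h, hxh, hhV, ?_⟩
  obtain ⟨k, hk⟩ := T.exists_pow_mul_sec_eq_zero (T.isCompact hh) g (rs _ hhV s)
    (fun V' hV' hV'g ↦ by
      have : V' ≤ cut (T.D g) V := fun y hy ↦ mem_cut.2 ⟨hV'g hy, hhV (hV' hy)⟩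
      rw [rs_rs, ← rs_rs (cut_le (T.D g) V) this, hs, map_zero])
  exact (T.bijective_pow_of_bijective hM k _).1 (hk.trans (map_zero _).symm)

/-- If `g` is invertible on `M`, then the sections of the sheaf associated with `M` over `V` and
over `V ∩ D g` agree. -/
lemma isIso_toSecOn : IsIso ((toSecOn (T.D g)).app (T.Φ.obj M)) := by
  have : Mono ((toSecOn (T.D g)).app (T.Φ.obj M)) := by
    rw [TopCat.Sheaf.mono_iff_injective]
    exact fun V s hs ↦ T.sec_eq_zero_of_rs_cut_eq_zero hM s hs
  have : Epi ((toSecOn (T.D g)).app (T.Φ.obj M)) := by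
    rw [epi_iff_local]
    intro V t x hx
    obtain ⟨W, h, t', hxW, e⟩ := T.exists_local_extension hM t hx
    exact ⟨W, h, t', hxW, e⟩
  exact isIso_of_mono_of_epi _

end Bijective

/-! ### Cohomology classes vanishing where a function is invertible -/

variable {i : ℕ}

lemma coh_eq_zero_of_pow {g : R} {k : ℕ} (h : V ≤ T.D g) {ξ : Coh (T.Φ.obj M) V i}
    (hξ : Coh.map V i (T.mul (g ^ k) M) ξ = 0) : ξ = 0 :=
  Coh.eq_zero_of_map_eq_zero (fun _ hV ↦ T.bijective_pow M k (hV.trans h)) ξ hξ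

variable (i) in
/-- Classes of degree `i` over quasi-compact open subsets are killed by powers of `f` if the basic
open subset defined by `f` is contained in the given open subset. -/
def Torsion : Prop :=
  ∀ (M : ModuleCat.{u} R) (W : Opens X) (f : R), IsCompact (W : Set X) → T.Good f → T.D f ≤ W →
    ∀ ξ : Coh (T.Φ.obj M) W i, ∃ k : ℕ, Coh.map W i (T.mul (f ^ k) M) ξ = 0

variable {T} in
/-- Vanishing of the cohomology over basic open subsets. -/
lemma Torsion.coh_eq_zero (h : T.Torsion i) {g : R} (hg : T.Good g) (ξ : Coh (T.Φ.obj M) (T.D g) i) :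
    ξ = 0 := by
  obtain ⟨k, hk⟩ := h M (T.D g) g (T.isCompact hg) hg le_rfl ξ
  exact T.coh_eq_zero_of_pow le_rfl hk

/-- The sheaf of `M` is the direct image of its restriction to `D g`. The sets `D g ∩ D h = D (g *
h)` have no cohomology in degrees `1, …, i` by the torsion hypothesis, so
`Coh.eq_zero_of_res_cut_eq_zero` applies. -/
lemma coh_eq_zero_of_res_eq_zero {g : R} (hM : Function.Bijective fun m : M ↦ g • m)
    (hT : ∀ q, q + 1 ≤ i → T.Torsion (q + 1)) (hW : T.D g ≤ W)
    (ξ : Coh (T.Φ.obj M) W (i + 1)) (hξ : Coh.res _ _ hW ξ = 0) : ξ = 0 := by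
  have := T.isIso_toSecOn hM
  refine Coh.eq_zero_of_res_cut_eq_zero (T.D g) (B := fun V ↦ ∃ h, T.Good h ∧ T.D h = V)
    (fun V x hx ↦ ?_) ?_ ξ ?_
  · obtain ⟨h, hh, hxh, hhV⟩ := T.exists_good V x hx
    exact ⟨T.D h, hhV, hxh, h, hh, rfl⟩
  · rintro q hq _ ⟨h, hh, rfl⟩
    have e : cut (T.D g) (T.D h) = T.D (g * h) := by
      rw [T.D_mul]
      exact Opens.ext (Set.ext fun x ↦ mem_cut)
    rw [e]
    exact (hT q hq).coh_eq_zero (T.good_mul g hh)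
  · have h : cut (T.D g) W ≤ T.D g := fun x hx ↦ (mem_cut.1 hx).1
    rw [← Coh.res_res hW h, hξ, map_zero]

/-- The product of the localizations of a module at finitely many elements. -/
abbrev prodAway (M : ModuleCat.{u} R) (t : Finset R) : ModuleCat.{u} R :=
  ModuleCat.of R (∀ g : t, LocalizedModule (.powers (g : R)) M)

/-- The canonical map to the product of localizations. -/
abbrev toProdAway (M : ModuleCat.{u} R) (t : Finset R) : M ⟶ prodAway M t :=
  ModuleCat.ofHom (LinearMap.pi fun g : t ↦ LocalizedModule.mkLinearMap (.powers (g : R)) M)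

/-- The projections of the product of localizations. -/
abbrev projAway (M : ModuleCat.{u} R) (t : Finset R) (g : t) :
    prodAway M t ⟶ ModuleCat.of R (LocalizedModule (.powers (g : R)) M) :=
  ModuleCat.ofHom (LinearMap.proj g)

lemma coh_prodAway_eq_zero {t : Finset R} (ξ : Coh (T.Φ.obj (prodAway M t)) W i)
    (h : ∀ g : t, Coh.map W i (T.Φ.map (projAway M t g)) ξ = 0) : ξ = 0 := by
  classical
  have e : 𝟙 (prodAway M t) = ∑ g, projAway M t g ≫ (ModuleCat.ofHom
      (LinearMap.single R (fun g : t ↦ LocalizedModule (.powers (g : R)) M) g) :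
        ModuleCat.of R (LocalizedModule (.powers (g : R)) M) ⟶ prodAway M t) := by
    ext x g
    simp [ModuleCat.hom_sum, Finset.sum_apply]
  let ev : (T.Φ.obj (prodAway M t) ⟶ T.Φ.obj (prodAway M t)) →+
      Coh (T.Φ.obj (prodAway M t)) W i :=
    AddMonoidHom.mk' (fun φ ↦ Coh.map W i φ ξ) fun φ ψ ↦ Coh.map_add φ ψ ξ
  have h₁ : ξ = ev (T.Φ.map (𝟙 _)) := by
    simp [ev]
  rw [h₁, e, Functor.map_sum, map_sum]
  refine Finset.sum_eq_zero fun g _ ↦ ?_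
  change Coh.map W i _ ξ = 0
  rw [Functor.map_comp, Coh.map_comp, h, map_zero]

lemma bijective_smul_localizedModule (M : ModuleCat.{u} R) (g : R) : Function.Bijective
    fun m : ModuleCat.of R (LocalizedModule (.powers g) M) ↦ g • m :=
  (Module.End.isUnit_iff _).1 (IsLocalizedModule.map_units
    (LocalizedModule.mkLinearMap (.powers g) M) ⟨g, Submonoid.mem_powers g⟩)

lemma exists_pow_smul_eq_zero_of_toProdAway_eq_zero {t : Finset R} {m : M}
    (h : toProdAway M t m = 0) {g : R} (hg : g ∈ t) : ∃ k : ℕ, g ^ k • m = 0 := by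
  have h₁ : LocalizedModule.mkLinearMap (.powers g) M m = 0 := congrFun h ⟨g, hg⟩
  obtain ⟨⟨_, k, rfl⟩, e⟩ := (IsLocalizedModule.eq_zero_iff (.powers g) _).1 h₁
  exact ⟨k, e⟩

/-- The step from modules mapping injectively to a finite product of localizations. -/
lemma exists_pow_of_map_eq_zero {S : ShortComplex (ModuleCat.{u} R)} (hS : S.ShortExact)
    (hT : ∀ q, q + 1 ≤ i → T.Torsion (q + 1)) {f : R} (hW : IsCompact (W : Set X)) (hf : T.Good f)
    (hfW : T.D f ≤ W) (ξ : Coh (T.Φ.obj S.X₁) W (i + 1))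
    (hξ : Coh.map W (i + 1) (T.Φ.map S.f) ξ = 0) :
    ∃ k : ℕ, Coh.map W (i + 1) (T.mul (f ^ k) S.X₁) ξ = 0 := by
  obtain ⟨η, rfl⟩ := Coh.exact₁ (T.shortExact_map hS) ξ hξ
  have hδ (k : ℕ) (η : Coh (T.Φ.obj S.X₃) W i) :
      Coh.map W (i + 1) (T.mul (f ^ k) S.X₁) (Coh.δ (T.shortExact_map hS) W i η) =
        Coh.δ (T.shortExact_map hS) W i (Coh.map W i (T.mul (f ^ k) S.X₃) η) :=
    Coh.map_δ (T.shortExact_map hS) (T.shortExact_map hS)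
      (T.Φ.mapShortComplex.map (f ^ k • 𝟙 S)) η
  cases i with
  | zero =>
    obtain ⟨s, rfl⟩ := (Coh.sec (T.Φ.obj S.X₃) W).surjective η
    -- On `D f` the section `f ^ k` times `s` comes from an element `c`, which lifts to `n` in
    -- `S.X₂`. The difference over `W` vanishes on `D f`, hence is killed by some `f ^ l`. So `f ^
    -- (l + k)` times `s` lifts to `S.X₂` and its coboundary vanishes.
    obtain ⟨k, c, hc⟩ := T.exists_τ (M := S.X₃) hf (rs _ hfW s)
    obtain ⟨n, rfl⟩ := (ModuleCat.epi_iff_surjective S.g).1 hS.epi_g c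
    obtain ⟨l, hl⟩ := T.exists_pow_mul_sec_eq_zero hW f
      (ap (T.mul (f ^ k) S.X₃) W s - ap (T.Φ.map S.g) W (T.τ S.X₂ W n)) (fun V hV hVf ↦ by
        rw [map_sub, sub_eq_zero, T.ap_τ, T.rs_τ, rs_ap, ← rs_rs hfW hVf, ← rs_ap, hc, T.rs_τ])
    refine ⟨l + k, ?_⟩
    rw [hδ]
    have e : Coh.map W 0 (T.mul (f ^ (l + k)) S.X₃) (Coh.sec (T.Φ.obj S.X₃) W s) =
        Coh.map W 0 (T.Φ.map S.g) (Coh.sec (T.Φ.obj S.X₂) W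
          (ap (T.mul (f ^ l) S.X₂) W (T.τ S.X₂ W n))) := by
      rw [map_sub, sub_eq_zero, T.ap_mul_ap_mul, ← pow_add, T.ap_mul_map] at hl
      rw [Coh.map_sec, Coh.map_sec, hl]
    rw [e]
    exact Coh.δ_map (T.shortExact_map hS) _
  | succ i =>
    obtain ⟨k, hk⟩ := hT i (by omega) S.X₃ W f hW hf hfW η
    exact ⟨k, (hδ k η).trans ((congrArg _ hk).trans (map_zero _))⟩

/-- Classes of positive degree over a quasi-compact open subset `W` are killed by powers of `f` if
the basic open subset defined by `f` is contained in `W`. -/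
theorem torsion_succ (i : ℕ) : T.Torsion (i + 1) := by
  induction i using Nat.strong_induction_on with
  | _ i ih =>
  intro M W f hW hf hfW ξ
  have hT : ∀ q, q + 1 ≤ i → T.Torsion (q + 1) := fun q hq ↦ ih q (by omega)
  obtain ⟨t, ht, htW⟩ := T.exists_finset_cover hW
    (P := fun g ↦ T.Good g ∧ ∃ h : T.D g ≤ W, Coh.res _ _ h ξ = 0) (fun x hx ↦ by
      obtain ⟨V, hV, hxV, e⟩ := Coh.exists_res_eq_zero ξ hx
      obtain ⟨g, hg, hxg, hgV⟩ := T.exists_good V x hxV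
      exact ⟨g, hxg, hg, hgV.trans hV, by rw [← Coh.res_res hV hgV, e, map_zero]⟩)
  let φ := toProdAway M t
  have hS := TopCat.Sheaf.shortExact_kernel_image φ
  have hS' := TopCat.Sheaf.shortExact_image_cokernel φ
  -- In each factor `M_g` the image of `ξ` restricts to zero on `D g`, where `ξ` itself vanishes, so
  -- it is zero over `W`.
  have hφ : Coh.map W (i + 1) (T.Φ.map φ) ξ = 0 := by
    refine T.coh_prodAway_eq_zero _ fun g ↦ ?_
    obtain ⟨hg, hgW, e⟩ := ht g g.2
    refine T.coh_eq_zero_of_res_eq_zero (bijective_smul_localizedModule M g) hT hgW _ ?_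
    rw [Coh.res_map, Coh.res_map, e, map_zero, map_zero]
  -- The image of `M` embeds into the product, where the class dies; lower degrees then provide the
  -- power of `f`.
  obtain ⟨k, hk⟩ := T.exists_pow_of_map_eq_zero hS' hT hW hf hfW
    (Coh.map W (i + 1) (T.Φ.map (Abelian.factorThruImage φ)) ξ) (by
      dsimp only
      rw [← Coh.map_comp, ← Functor.map_comp, Abelian.image.fac, hφ])
  refine ⟨k, ?_⟩
  have e : Coh.map W (i + 1) (T.Φ.map (Abelian.factorThruImage φ))
      (Coh.map W (i + 1) (T.mul (f ^ k) M) ξ) = 0 := by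
    rw [← Coh.map_comp, T.mul_map, Coh.map_comp]
    exact hk
  obtain ⟨η, hη⟩ := Coh.exact₂ (T.shortExact_map hS) _ e
  -- The kernel of `M → ∏ M_g` is killed elementwise by powers of each `g` in the cover, so its
  -- sheaf is zero on `W`.
  have h₀ : η = 0 := by
    refine Coh.eq_zero_of_sec_eq_zero (F := T.Φ.obj (Limits.kernel φ))
      (T.sec_eq_zero_of_forall_exists fun m x hx ↦ ?_) η
    obtain ⟨g, hg, hxg⟩ := htW x hx
    have hm : φ (Limits.kernel.ι φ m) = 0 := by
      rw [← ConcreteCategory.comp_apply, Limits.kernel.condition]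
      rfl
    obtain ⟨k, hk⟩ := exists_pow_smul_eq_zero_of_toProdAway_eq_zero hm hg
    refine ⟨g, k, hxg, (ModuleCat.mono_iff_injective (Limits.kernel.ι φ)).1 inferInstance ?_⟩
    rw [map_zero]
    exact (map_smul (Limits.kernel.ι φ).hom _ _).trans hk
  rw [← hη, h₀]
  exact map_zero _

end AssociatedSheaves

end

/-! ### The sheaves associated with modules on an open subscheme of `Spec R` -/

noncomputable section

open CategoryTheory AlgebraicGeometry TopologicalSpace Opposite
open TopCat.Sheaf

namespace AlgebraicGeometry.Scheme.Modules

section Tilde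

variable {R : CommRingCat.{u}} (M : ModuleCat.{u} R)

/-- The basic open subset of `Spec R` defined by `g`. -/
abbrev specBasicOpen (g : R) : (Spec R).Opens := PrimeSpectrum.basicOpen g

lemma comapₗ_smul_id (r : R) (V : TopologicalSpace.Opens (PrimeSpectrum.Top R))
    (s : (structureSheafInType R M).obj.obj (op V)) :
    StructureSheaf.comapₗ (r • LinearMap.id : M →ₗ[R] M) V V .rfl s = r • s := by
  refine Subtype.ext (funext fun y ↦ ?_)
  change StructureSheaf.Localizations.comapFun (r • LinearMap.id : M →ₗ[R] M) y.1 (s.1 y) =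
    r • s.1 y
  induction s.1 y using LocalizedModule.induction_on with
  | _ a b =>
    have h : StructureSheaf.Localizations.comapFun (r • LinearMap.id : M →ₗ[R] M) y.1
        (LocalizedModule.mk a b) = LocalizedModule.mk (r • a) b :=
      StructureSheaf.Localizations.comapFun_mk (σ := RingHom.id R)
        (r • LinearMap.id : M →ₗ[R] M) y.1 a b
    exact h.trans (LocalizedModule.smul'_mk r a b).symm

/-- Links scalars acting through functoriality, as used in `AssociatedSheaves`, to the module
structure on sections, for which the localization results are stated. -/
lemma tilde_map_smul_id_app (r : R) (V : (Spec R).Opens) (s : Γ(tilde M, V)) :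
    (tilde.map (r • 𝟙 M)).app V s = r • s :=
  (comapₗ_smul_id M r V s).trans
    (IsScalarTower.algebraMap_smul (M := ((structureSheafInType R M).obj.obj (op V)))
      ((structureSheafInType R R).obj.obj (op V)) r
      (show (structureSheafInType R M).obj.obj (op V) from s)).symm

/-- The sections of `tilde M` given by elements of `M`. -/
def tildeSection (V : (Spec R).Opens) : M →+ Γ(tilde M, V) :=
  (tilde.toOpen M V).hom.toAddMonoidHom

lemma tildeSection_res {V W : (Spec R).Opens} (i : W ⟶ V) (m : M) :
    (tilde M).presheaf.map i.op (tildeSection M V m) = tildeSection M W m :=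
  ConcreteCategory.congr_hom (tilde.toOpen_res M V W i) m

lemma tilde_map_app_tildeSection {M N : ModuleCat.{u} R} (φ : M ⟶ N) (V : (Spec R).Opens) (m : M) :
    (tilde.map φ).app V (tildeSection M V m) = tildeSection N V (φ m) :=
  ConcreteCategory.congr_hom (tilde.toOpen_map_app φ V) m

lemma exists_pow_smul_eq_tildeSection (g : R) (s : Γ(tilde M, specBasicOpen g)) :
    ∃ (n : ℕ) (m : M), g ^ n • s = tildeSection M _ m := by
  obtain ⟨⟨m, _, n, rfl⟩, e⟩ :=
    IsLocalizedModule.surj (.powers g) (tilde.toOpen M (specBasicOpen g)).hom s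
  exact ⟨n, m, e⟩

lemma exists_pow_smul_eq_zero_of_tildeSection (g : R) (m : M)
    (h : tildeSection M (specBasicOpen g) m = 0) : ∃ n : ℕ, g ^ n • m = 0 := by
  obtain ⟨⟨_, n, rfl⟩, e⟩ :=
    (IsLocalizedModule.eq_zero_iff (.powers g) (tilde.toOpen M (specBasicOpen g)).hom).1 h
  exact ⟨n, e⟩

lemma bijective_tilde_map_smul_id {g : R} {V : (Spec R).Opens} (hV : V ≤ specBasicOpen g) :
    Function.Bijective ((tilde.map (g • 𝟙 M)).app V) := by
  have h : ⇑((tilde.map (g • 𝟙 M)).app V) = fun s ↦ g • s :=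
    funext fun s ↦ tilde_map_smul_id_app M g V s
  rw [h]
  exact (Module.End.isUnit_iff _).1
    (isUnit_algebraMap_end_of_le_basicOpen (M := tilde M) g hV)

end Tilde

variable {R : Type u} [CommRing R] {U : Scheme.{u}} (j : U ⟶ Spec (.of R)) [IsOpenImmersion j]

/-- The abelian sheaf on an open subscheme of `Spec R` associated with an `R`-module. -/
def restrictTilde : ModuleCat.{u} R ⥤ TopCat.Sheaf AddCommGrpCat.{u} U :=
  tilde.functor (.of R) ⋙ restrictFunctor j ⋙ SheafOfModules.toSheaf U.ringCatSheaf

lemma image_preimage_specBasicOpen {g : R} (hg : specBasicOpen (R := .of R) g ≤ j.opensRange) :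
    j ''ᵁ j ⁻¹ᵁ (specBasicOpen (R := .of R) g) = specBasicOpen (R := .of R) g := by
  rw [Hom.image_preimage_eq_opensRange_inf]
  exact inf_eq_right.2 hg

lemma image_le_of_le_preimage {V : U.Opens} {W : (Spec (.of R)).Opens} (h : V ≤ j ⁻¹ᵁ W) :
    j ''ᵁ V ≤ W := by
  rintro _ ⟨x, hx, rfl⟩
  exact h hx

/-- The abelian sheaves on an open subscheme of `Spec R` associated with `R`-modules. -/
def associatedSheaves : AssociatedSheaves R U where
  Φ := restrictTilde j
  additive :=
    haveI : (tilde.functor (.of R)).Additive :=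
      instAdditiveModuleCatCarrierModulesSpecOfFunctor
    haveI : (restrictFunctor j ⋙ SheafOfModules.toSheaf U.ringCatSheaf).Additive :=
      { map_add := rfl }
    inferInstanceAs (tilde.functor (.of R) ⋙ restrictFunctor j ⋙
      SheafOfModules.toSheaf U.ringCatSheaf).Additive
  D f := j ⁻¹ᵁ specBasicOpen (R := .of R) f
  Good f := specBasicOpen (R := .of R) f ≤ j.opensRange
  D_mul f g := by
    rw [specBasicOpen, PrimeSpectrum.basicOpen_mul]
    rfl
  good_mul f {g} hg := by
    rw [specBasicOpen, PrimeSpectrum.basicOpen_mul]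
    exact inf_le_right.trans hg
  exists_good V x hx := by
    obtain ⟨_, ⟨_, ⟨g, rfl⟩, rfl⟩, hxg, hgV⟩ :=
      PrimeSpectrum.isBasis_basic_opens.exists_subset_of_mem_open
        (show j x ∈ (j ''ᵁ V : Set (Spec (.of R))) from ⟨x, hx, rfl⟩) (j ''ᵁ V).2
    refine ⟨g, hgV.trans (Set.image_subset_range _ _), hxg, fun y hy ↦ ?_⟩
    obtain ⟨z, hz, e⟩ := hgV (show j y ∈ PrimeSpectrum.basicOpen g from hy)
    rwa [← j.injective e]
  isCompact {g} hg := by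
    rw [j.isOpenEmbedding.isInducing.isCompact_iff]
    have h := congrArg (fun V : (Spec (.of R)).Opens ↦ (V : Set (Spec (.of R))))
      (image_preimage_specBasicOpen j hg)
    have h' : IsCompact (specBasicOpen (R := .of R) g : Set (Spec (.of R))) :=
      PrimeSpectrum.isCompact_basicOpen g
    rw [← h] at h'
    exact h'
  τ M V := tildeSection (R := .of R) M (j ''ᵁ V)
  rs_τ {M V W} h m := tildeSection_res (R := .of R) M (j.opensFunctor.map (homOfLE h)) m
  ap_τ {M N} φ V m := tilde_map_app_tildeSection (R := .of R) φ (j ''ᵁ V) m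
  exists_τ {g} hg {M} s := by
    -- The image of the inverse image of `D(g)` is only propositionally `D(g)`; a variable `V`
    -- allows substitution.
    have key (V : (Spec (.of R)).Opens) (hV : V = specBasicOpen (R := .of R) g)
        (s : Γ(tilde (R := .of R) M, V)) : ∃ (n : ℕ) (m : M),
        (tilde.map (R := .of R) (g ^ n • 𝟙 M)).app V s = tildeSection (R := .of R) M V m := by
      subst hV
      obtain ⟨n, m, e⟩ := exists_pow_smul_eq_tildeSection (R := .of R) M g s
      exact ⟨n, m, (tilde_map_smul_id_app (R := .of R) M (g ^ n) _ s).trans e⟩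
    exact key _ (image_preimage_specBasicOpen j hg) s
  exists_pow_smul {g} hg {M} m h := by
    have key (V : (Spec (.of R)).Opens) (hV : V = specBasicOpen (R := .of R) g)
        (h : tildeSection (R := .of R) M V m = 0) : ∃ n : ℕ, g ^ n • m = 0 := by
      subst hV
      exact exists_pow_smul_eq_zero_of_tildeSection (R := .of R) M g m h
    exact key _ (image_preimage_specBasicOpen j hg) h
  bijective M {g V} hV :=
    bijective_tilde_map_smul_id (R := .of R) M (image_le_of_le_preimage j hV)

end AlgebraicGeometry.Scheme.Modules

end

/-! ### Exactness of sheaves of modules on underlying abelian sheaves -/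

noncomputable section

open CategoryTheory AlgebraicGeometry TopologicalSpace Opposite

section ToSheaf

open Limits

variable {C : Type u} [SmallCategory C] {J : GrothendieckTopology C} (R : Sheaf J RingCat.{u})

/-- The presheaf cokernel of an epimorphism of sheaves sheafifies to zero as a module.
Sheafification of modules has the sheafification of abelian presheaves as underlying sheaf, and the
latter is exact, so `φ` stays epi on abelian sheaves. -/
lemma epi_toSheaf_map {M N : SheafOfModules.{u} R} (φ : M ⟶ N) [Epi φ] :
    Epi ((SheafOfModules.toSheaf.{u} R).map φ) := by
  let L := PresheafOfModules.sheafification.{u} (𝟙 R.obj)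
  let H := SheafOfModules.toSheaf.{u} R
  let i := SheafOfModules.forget.{u} R ⋙ PresheafOfModules.restrictScalars (𝟙 R.obj)
  let adj : L ⊣ i := PresheafOfModules.sheafificationAdjunction (𝟙 R.obj)
  have hε : IsIso adj.counit :=
    inferInstanceAs (IsIso (PresheafOfModules.sheafificationAdjunction (𝟙 R.obj)).counit)
  let e (P) : L.obj (i.obj P) ≅ P := (asIso adj.counit).app P
  have he : L.map (i.map φ) ≫ (e N).hom = (e M).hom ≫ φ := adj.counit.naturality φ
  have h₁ : Epi (L.map (i.map φ)) := by
    have : L.map (i.map φ) = (e M).hom ≫ φ ≫ (e N).inv := by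
      rw [← reassoc_of% he, Iso.hom_inv_id, Category.comp_id]
    rw [this]
    infer_instance
  have h₂ : L.map (cokernel.π (i.map φ)) = 0 := by
    rw [← cancel_epi (L.map (i.map φ)), ← L.map_comp, cokernel.condition, comp_zero]
    have := adj.left_adjoint_additive
    exact L.map_zero _ _
  let K := PresheafOfModules.toPresheaf.{u} R.obj ⋙ presheafToSheaf J AddCommGrpCat.{u}
  have h₃ : ((ShortComplex.mk (i.map φ) (cokernel.π (i.map φ)) (by simp)).map K).Exact :=
    (ShortComplex.exact_cokernel (i.map φ)).map K
  have h₄ : K.map (cokernel.π (i.map φ)) = 0 := congrArg H.map h₂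
  have h₅ : Epi (K.map (i.map φ)) := h₃.epi_f h₄
  have h₆ : H.map (L.map (i.map φ)) ≫ H.map (e N).hom = H.map (e M).hom ≫ H.map φ := by
    rw [← H.map_comp, he, H.map_comp]
  have h₇ : Epi (H.map (L.map (i.map φ))) := h₅
  exact epi_of_epi_fac h₆.symm

instance : (SheafOfModules.toSheaf.{u} R).PreservesEpimorphisms where
  preserves φ _ := epi_toSheaf_map R φ

instance : (SheafOfModules.toSheaf.{u} R).PreservesHomology :=
  Functor.preservesHomology_of_preservesEpis_and_kernels _

lemma SheafOfModules.exact_iff_toSheaf (S : ShortComplex (SheafOfModules.{u} R)) :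
    S.Exact ↔ (S.map (SheafOfModules.toSheaf.{u} R)).Exact :=
  (ShortComplex.exact_map_iff_of_faithful S (SheafOfModules.toSheaf.{u} R)).symm

end ToSheaf

namespace AlgebraicGeometry.Scheme.Modules

/-- The forgetful functor from sheaves of modules to abelian sheaves. -/
def toAb (X : Scheme.{u}) : X.Modules ⥤ TopCat.Sheaf AddCommGrpCat.{u} X :=
  SheafOfModules.toSheaf X.ringCatSheaf

instance (X : Scheme.{u}) : (toAb X).Additive where
  map_add := rfl

lemma exact_iff_toAb {X : Scheme.{u}} (S : ShortComplex X.Modules) :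
    S.Exact ↔ (S.map (toAb X)).Exact :=
  SheafOfModules.exact_iff_toSheaf X.ringCatSheaf S

end AlgebraicGeometry.Scheme.Modules

end

/-! ### The isomorphism between `𝒪 ⊗ j_* 𝒪_U` and `j_* j^* 𝒪` -/

noncomputable section

open CategoryTheory AlgebraicGeometry TopologicalSpace Opposite

namespace AlgebraicGeometry.Scheme.Modules

section

variable {X U : Scheme.{u}} (j : U ⟶ X) [IsOpenImmersion j]

lemma smul_pushforward_restrict (K : X.Modules) (V : X.Opens) (f : Γ(X, V))
    (y : Γ(K, j ''ᵁ j ⁻¹ᵁ V)) :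
    f • (show Γ((pushforward j).obj ((restrictFunctor j).obj K), V) from y) =
      (show Γ((pushforward j).obj ((restrictFunctor j).obj K), V) from
        X.presheaf.map (homOfLE (j.image_preimage_le V)).op f • y) :=
  congrArg (fun g : Γ(X, j ''ᵁ j ⁻¹ᵁ V) ↦ g • y)
    (ConcreteCategory.congr_hom (j.app_appIso_inv V) f)

/-- The direct image of the structure sheaf of an open subscheme. -/
abbrev directImageUnit : X.Modules := (pushforward j).obj (structureSheaf U)

/-- The structure sheaf tensored with a sheaf of modules, as a presheaf. -/
def presheafUnitTensorIso (F : X.Modules) :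
    (presheafTensorRight F).obj ((toPresheafOfModules X).obj (structureSheaf X)) ≅
      (toPresheafOfModules X).obj F :=
  MonoidalCategory.leftUnitor
    (C := _root_.PresheafOfModules.{u} (X.presheaf ⋙ forget₂ CommRingCat RingCat)) F.val

lemma presheafUnitTensorIso_hom_tmul (F : X.Modules) (V : X.Opens) (a : Γ(X, V)) (s : Γ(F, V)) :
   ((presheafUnitTensorIso F).hom.app (op V)).hom (TensorProduct.tmul Γ(X, V) a s) = a • s :=
  TensorProduct.lid_tmul s a

end

section

variable {R : CommRingCat.{u}} {U : Scheme.{u}} (j : U ⟶ Spec R) [IsOpenImmersion j]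

/-- The comparison of `𝒪 ⊗ j_* 𝒪_U` with `j_* j^* 𝒪` on presheaves. -/
def presheafUnitComparison :
    (presheafTensorRight (directImageUnit j)).obj
      ((toPresheafOfModules _).obj (tilde (ModuleCat.of R R))) ⟶
    (toPresheafOfModules _).obj ((pushforward j).obj ((restrictFunctor j).obj
      (tilde (ModuleCat.of R R)))) :=
  (presheafUnitTensorIso (directImageUnit j)).hom ≫
    (toPresheafOfModules _).map ((pushforward j).map (restrictUnitIso j).inv)

lemma tilde_map_smul_id_pushforward_restrict (M : ModuleCat.{u} R) (r : R) (V : (Spec R).Opens)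
    (y : Γ((pushforward j).obj ((restrictFunctor j).obj (tilde M)), V)) :
    ((pushforward j).map ((restrictFunctor j).map (tilde.map (r • 𝟙 M)))).app V y =
      (Spec R).presheaf.map V.leTop.op ((Scheme.ΓSpecIso R).inv r) • y := by
  refine (tilde_map_smul_id_app M r (j ''ᵁ j ⁻¹ᵁ V) y).trans ?_
  refine Eq.trans ?_ (smul_pushforward_restrict j (tilde M) V _ y).symm
  refine (smul_Spec_def r _).trans ?_
  refine congrArg (fun f : Γ(Spec R, j ''ᵁ j ⁻¹ᵁ V) ↦ f • (show Γ(tilde M, j ''ᵁ j ⁻¹ᵁ V) from y))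
    ?_
  exact ConcreteCategory.congr_hom ((Spec R).presheaf.map_comp V.leTop.op
    (homOfLE (j.image_preimage_le V)).op) ((Scheme.ΓSpecIso R).inv r)

lemma presheafUnitComparison_app_tmul (V : (Spec R).Opens) (a : Γ(Spec R, V))
    (s : Γ(directImageUnit j, V)) :
    ((presheafUnitComparison j).app (op V)).hom (TensorProduct.tmul Γ(Spec R, V) a s) =
      ((pushforward j).map (restrictUnitIso j).inv).app V (a • s) :=
  congrArg (((pushforward j).map (restrictUnitIso j).inv).app V)
    (presheafUnitTensorIso_hom_tmul (directImageUnit j) V a s)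

/-- Compatibility with scalars alone is enough to extend the comparison to finite free modules. It
is checked on pure tensors, where both sides are multiplication by `r`. -/
lemma presheafUnitComparison_naturality (r : R) :
    (presheafTensorRight (directImageUnit j)).map
        ((toPresheafOfModules _).map (tilde.map (r • 𝟙 (ModuleCat.of R R)))) ≫
      presheafUnitComparison j =
    presheafUnitComparison j ≫ (toPresheafOfModules _).map ((pushforward j).map
      ((restrictFunctor j).map (tilde.map (r • 𝟙 (ModuleCat.of R R))))) := by
  refine PresheafOfModules.hom_ext fun V ↦ ?_
  obtain ⟨V⟩ := V
  refine ModuleCat.MonoidalCategory.tensor_ext (R := (Spec R).presheaf.obj (op V)) fun a' s ↦ ?_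
  let a : Γ(Spec R, V) := a'
  let c : Γ(Spec R, V) := (Spec R).presheaf.map V.leTop.op ((Scheme.ΓSpecIso R).inv r)
  have h₁ : (tilde.map (r • 𝟙 (ModuleCat.of R R))).app V a = (c * a) :=
    (tilde_map_smul_id_app (ModuleCat.of R R) r V a).trans
      (smul_Spec_def (M := tilde (ModuleCat.of R R)) r (show Γ(tilde (ModuleCat.of R R), V) from a))
  let e := (pushforward j).map (restrictUnitIso j).inv
  have h₂ : e.app V ((c * a) • s) = c • e.app V (a • s) :=
    (congrArg (e.app V) (mul_smul c _ s)).trans (Hom.app_smul e c _)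
  refine (presheafUnitComparison_app_tmul j V
    ((tilde.map (r • 𝟙 (ModuleCat.of R R))).app V a) s).trans ?_
  refine (congrArg (fun b : Γ(Spec R, V) ↦ e.app V (b • s)) h₁).trans (h₂.trans ?_)
  refine (tilde_map_smul_id_pushforward_restrict j (ModuleCat.of R R) r V _).symm.trans ?_
  exact congrArg (((pushforward j).map ((restrictFunctor j).map
    (tilde.map (r • 𝟙 (ModuleCat.of R R))))).app V)
    (presheafUnitComparison_app_tmul j V a s).symm

/-- The comparison of `𝒪 ⊗ j_* 𝒪_U` with `j_* j^* 𝒪`. -/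
def unitComparison :
    (tensorRight (directImageUnit j)).obj (tilde (ModuleCat.of R R)) ⟶
      (pushforward j).obj ((restrictFunctor j).obj (tilde (ModuleCat.of R R))) :=
  (sheafification _).map (presheafUnitComparison j) ≫
    (PresheafOfModules.sheafificationAdjunction (𝟙 (Spec R).ringCatSheaf.obj)).counit.app _

instance : IsIso (presheafUnitComparison j) := by
  have h : IsIso ((toPresheafOfModules _).map ((pushforward j).map (restrictUnitIso j).inv)) :=
    ((toPresheafOfModules _).mapIso ((pushforward j).mapIso (restrictUnitIso j).symm)).isIso_hom
  exact IsIso.comp_isIso' (Iso.isIso_hom _) h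

instance : IsIso (unitComparison j) := by
  have h₁ : IsIso ((PresheafOfModules.sheafificationAdjunction
    (𝟙 (Spec R).ringCatSheaf.obj)).counit.app ((pushforward j).obj ((restrictFunctor j).obj
      (tilde (ModuleCat.of R R))))) :=
    ((asIso (PresheafOfModules.sheafificationAdjunction
      (𝟙 (Spec R).ringCatSheaf.obj)).counit).app _).isIso_hom
  have h₂ : IsIso ((sheafification _).map (presheafUnitComparison j)) := inferInstance
  exact IsIso.comp_isIso' h₂ h₁

lemma unitComparison_naturality (r : R) :
    (tensorRight (directImageUnit j)).map (tilde.map (r • 𝟙 (ModuleCat.of R R))) ≫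
      unitComparison j =
    unitComparison j ≫ (pushforward j).map
      ((restrictFunctor j).map (tilde.map (r • 𝟙 (ModuleCat.of R R)))) := by
  let c := (PresheafOfModules.sheafificationAdjunction (𝟙 (Spec R).ringCatSheaf.obj)).counit
  have h₁ := congrArg (sheafification _).map (presheafUnitComparison_naturality j r)
  rw [Functor.map_comp, Functor.map_comp] at h₁
  have h₂ := c.naturality ((pushforward j).map
      ((restrictFunctor j).map (tilde.map (r • 𝟙 (ModuleCat.of R R)))))
  refine (Category.assoc _ _ _).symm.trans ?_
  refine (congrArg (· ≫ c.app _) h₁).trans ?_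
  refine (Category.assoc _ _ _).trans ?_
  refine (congrArg ((sheafification _).map (presheafUnitComparison j) ≫ ·) h₂).trans ?_
  exact (Category.assoc _ _ _).symm

end

end AlgebraicGeometry.Scheme.Modules

end

/-! ### Extension from `R` to complexes of finite free modules -/

noncomputable section

open CategoryTheory AlgebraicGeometry TopologicalSpace Opposite

section FreeExtension

variable {R : Type u} [CommRing R] {D : Type*} [Category D] [Preadditive D]
  (T₁ T₂ : ModuleCat.{u} R ⥤ D)
  (θ : T₁.obj (ModuleCat.of R R) ⟶ T₂.obj (ModuleCat.of R R))

-- The identity of a finite free module is a finite sum of maps factoring through `R`.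
variable {T₁} in
lemma Module.Free.functor_hom_ext [T₁.Additive] {M : ModuleCat.{u} R} [Module.Free R M] [Module.Finite R M] {X : D}
    {g h : T₁.obj M ⟶ X} (H : ∀ f : ModuleCat.of R R ⟶ M, T₁.map f ≫ g = T₁.map f ≫ h) : g = h := by
  let b := Module.Free.chooseBasis R M
  have e : 𝟙 M = ∑ k, (ModuleCat.ofHom (b.coord k) : M ⟶ ModuleCat.of R R) ≫
      ModuleCat.ofHom (LinearMap.toSpanSingleton R M (b k)) := by
    ext x
    simp [ModuleCat.hom_sum, b.sum_repr]
  rw [← Category.id_comp g, ← Category.id_comp h, ← T₁.map_id, e, T₁.map_sum,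
    Preadditive.sum_comp, Preadditive.sum_comp]
  simp [H]

/-- The extension of a morphism between the values at `R` of two additive functors to their values
at a finite free module. -/
def freeExtension (M : ModuleCat.{u} R) [Module.Free R M] [Module.Finite R M] :
    T₁.obj M ⟶ T₂.obj M :=
  ∑ k, T₁.map (ModuleCat.ofHom ((Module.Free.chooseBasis R M).coord k)) ≫ θ ≫
    T₂.map (ModuleCat.ofHom (LinearMap.toSpanSingleton R M (Module.Free.chooseBasis R M k)))

variable {T₁ T₂ θ} (hθ : ∀ r : R, T₁.map (r • 𝟙 _) ≫ θ = θ ≫ T₂.map (r • 𝟙 _))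
include hθ

lemma map_comp_freeExtension [T₂.Additive] {M : ModuleCat.{u} R} [Module.Free R M] [Module.Finite R M]
    (f : ModuleCat.of R R ⟶ M) : T₁.map f ≫ freeExtension T₁ T₂ θ M = θ ≫ T₂.map f := by
  let b := Module.Free.chooseBasis R M
  have e : f = ∑ k, b.coord k (f.hom 1) •
      ModuleCat.ofHom (LinearMap.toSpanSingleton R M (b k)) := by
    ext
    simp [ModuleCat.hom_sum, b.sum_repr]
  have hk (k) : f ≫ ModuleCat.ofHom (b.coord k) = b.coord k (f.hom 1) • 𝟙 (ModuleCat.of R R) := by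
    ext
    simp
  conv_rhs => rw [e, T₂.map_sum, Preadditive.comp_sum]
  rw [freeExtension, Preadditive.comp_sum]
  refine Finset.sum_congr rfl fun k _ ↦ ?_
  rw [← Category.assoc, ← T₁.map_comp, hk, reassoc_of% hθ, ← T₂.map_comp]
  simp [b]

variable [T₁.Additive] [T₂.Additive]

lemma freeExtension_naturality {M N : ModuleCat.{u} R} [Module.Free R M] [Module.Finite R M]
    [Module.Free R N] [Module.Finite R N] (φ : M ⟶ N) :
    T₁.map φ ≫ freeExtension T₁ T₂ θ N = freeExtension T₁ T₂ θ M ≫ T₂.map φ := by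
  refine Module.Free.functor_hom_ext fun f ↦ ?_
  rw [← Category.assoc, ← T₁.map_comp, map_comp_freeExtension hθ, ← Category.assoc,
    map_comp_freeExtension hθ, Category.assoc, ← T₂.map_comp]

/-- The inverse is the extension of `inv θ`. -/
lemma isIso_freeExtension [IsIso θ] (M : ModuleCat.{u} R) [Module.Free R M] [Module.Finite R M] :
    IsIso (freeExtension T₁ T₂ θ M) := by
  have hθ' (r : R) : T₂.map (r • 𝟙 _) ≫ inv θ = inv θ ≫ T₁.map (r • 𝟙 _) := by
    rw [IsIso.comp_inv_eq, Category.assoc, hθ, IsIso.inv_hom_id_assoc]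
  refine ⟨freeExtension T₂ T₁ (inv θ) M, Module.Free.functor_hom_ext fun f ↦ ?_,
    Module.Free.functor_hom_ext fun f ↦ ?_⟩
  · rw [← Category.assoc, map_comp_freeExtension hθ, Category.assoc, map_comp_freeExtension hθ']
    simp
  · rw [← Category.assoc, map_comp_freeExtension hθ', Category.assoc, map_comp_freeExtension hθ]
    simp

/-- Two additive functors with isomorphic values at `R` have isomorphic values at complexes of
finite free modules. -/
def freeComplexIso [IsIso θ] (G : ChainComplex (ModuleCat.{u} R) ℕ) [∀ i, Module.Free R (G.X i)]
    [∀ i, Module.Finite R (G.X i)] :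
    (T₁.mapHomologicalComplex _).obj G ≅ (T₂.mapHomologicalComplex _).obj G :=
  HomologicalComplex.Hom.isoOfComponents
    (fun i ↦ @asIso _ _ _ _ (freeExtension T₁ T₂ θ (G.X i)) (isIso_freeExtension hθ _))
    (fun i k _ ↦ (freeExtension_naturality hθ (G.d i k)).symm)

end FreeExtension

namespace AlgebraicGeometry.Scheme.Modules

open TopCat.Sheaf

variable {R : Type u} [CommRing R] {U : Scheme.{u}} (j : U ⟶ Spec (.of R)) [IsOpenImmersion j]
  (G : ChainComplex (ModuleCat.{u} R) ℕ)

instance : (tilde.functor (.of R)).Additive :=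
  instAdditiveModuleCatCarrierModulesSpecOfFunctor

instance : (restrictTilde j).Additive := (associatedSheaves j).additive

/-- The complex of abelian sheaves on an open subscheme of `Spec R` associated with a complex of
`R`-modules. -/
def restrictTildeComplex : ChainComplex (TopCat.Sheaf AddCommGrpCat.{u} U) ℕ :=
  ((restrictTilde j).mapHomologicalComplex _).obj G

lemma exactAt_restrictComplex_iff (p : ℕ) :
    (restrictComplex j (tildeComplex G)).ExactAt (p + 1) ↔
      (restrictTildeComplex j G).ExactAt (p + 1) := by
  rw [HomologicalComplex.exactAt_iff' _ (p + 2) (p + 1) p (by simp) (by simp),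
    HomologicalComplex.exactAt_iff' _ (p + 2) (p + 1) p (by simp) (by simp), exact_iff_toAb]
  rfl

/-- Finite freeness replaces the tensor product by the direct image of the restricted complex, whose
exactness is visible on the stalks of `H⁰`. -/
lemma exactAt_tensorDirectImage_iff [∀ i, Module.Free R (G.X i)] [∀ i, Module.Finite R (G.X i)]
    (p : ℕ) : (tensorDirectImage G j).ExactAt (p + 1) ↔
      ∀ (x : Spec (.of R)) (t : (cohStalk j.base x 0).obj ((restrictTildeComplex j G).X (p + 1))),
        (cohStalk j.base x 0).map ((restrictTildeComplex j G).d (p + 1) p) t = 0 →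
          ∃ t', (cohStalk j.base x 0).map ((restrictTildeComplex j G).d (p + 2) (p + 1)) t' = t := by
  let T₁ : ModuleCat.{u} R ⥤ (Spec (.of R)).Modules :=
    tilde.functor (.of R) ⋙ tensorRight (directImageUnit j)
  let T₂ : ModuleCat.{u} R ⥤ (Spec (.of R)).Modules :=
    tilde.functor (.of R) ⋙ restrictFunctor j ⋙ pushforward j
  let θ : T₁.obj (ModuleCat.of R R) ⟶ T₂.obj (ModuleCat.of R R) := unitComparison (R := .of R) j
  have : IsIso θ := inferInstanceAs (IsIso (unitComparison (R := .of R) j))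
  have hθ (r : R) : T₁.map (r • 𝟙 _) ≫ θ = θ ≫ T₂.map (r • 𝟙 _) :=
    unitComparison_naturality (R := .of R) j r
  let e : tensorDirectImage G j ≅ (T₂.mapHomologicalComplex _).obj G := freeComplexIso hθ G
  rw [show (tensorDirectImage G j).ExactAt (p + 1) ↔ _ from
      ⟨fun h ↦ h.of_iso e, fun h ↦ h.of_iso e.symm⟩,
    HomologicalComplex.exactAt_iff' _ (p + 2) (p + 1) p (by simp) (by simp), exact_iff_toAb]
  exact exact_pushforward_iff_cohStalk j.base ((restrictTildeComplex j G).sc' (p + 2) (p + 1) p)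

end AlgebraicGeometry.Scheme.Modules

end

/-! ### Torsion in the higher direct images, and the theorem -/

noncomputable section

open CategoryTheory AlgebraicGeometry TopologicalSpace Opposite

namespace AssociatedSheaves

open TopCat.Sheaf

variable {R : Type u} [CommRing R] {X : TopCat.{u}} (T : AssociatedSheaves R X)

/-- `D f` need not lie in `W`, so the torsion theorem is applied to `f * h`; the powers of `h` are
then cancelled, as `h` is invertible on `W`. -/
lemma exists_pow_coh_eq_zero {M : ModuleCat.{u} R} {W : Opens X} {f h : R} {i : ℕ}
    (hW : IsCompact (W : Set X)) (hf : T.Good f) (hWh : W ≤ T.D h) (hfh : T.D (f * h) ≤ W)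
    (ξ : Coh (T.Φ.obj M) W (i + 1)) : ∃ k : ℕ, Coh.map W (i + 1) (T.mul (f ^ k) M) ξ = 0 := by
  obtain ⟨k, hk⟩ := T.torsion_succ i M W (f * h) hW (by rw [mul_comm]; exact T.good_mul h hf) hfh ξ
  rw [mul_pow, T.mul_mul, Coh.map_comp] at hk
  exact ⟨k, T.coh_eq_zero_of_pow hWh hk⟩

end AssociatedSheaves

namespace AlgebraicGeometry.Scheme.Modules

open TopCat.Sheaf

variable {R : Type u} [CommRing R] {U : Scheme.{u}} (j : U ⟶ Spec (.of R)) [IsOpenImmersion j]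

/-- The functor is additive, so its value at a finite free module is determined through maps from
`R`. -/
lemma cohStalk_restrictTilde_eq_zero {x : Spec (.of R)} {i : ℕ}
    (h : ∀ t : (cohStalk j.base x i).obj ((restrictTilde j).obj (ModuleCat.of R R)), t = 0)
    (M : ModuleCat.{u} R) [Module.Free R M] [Module.Finite R M]
    (t : (cohStalk j.base x i).obj ((restrictTilde j).obj M)) : t = 0 := by
  let E : ModuleCat.{u} R ⥤ AddCommGrpCat.{u} := restrictTilde j ⋙ cohStalk j.base x i
  have : E.Additive := inferInstance
  have e : 𝟙 (E.obj M) = 0 := Module.Free.functor_hom_ext fun f ↦ by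
    ext s
    rw [h s, map_zero, map_zero]
  exact congrArg (fun g : E.obj M ⟶ E.obj M ↦ g t) e

lemma isZero_higherDirectImage_iff (i : ℕ) :
    Limits.IsZero (higherDirectImage j (i + 1) (structureSheaf U)) ↔ ∀ (x : Spec (.of R))
      (t : (cohStalk j.base x (i + 1)).obj ((restrictTilde j).obj (ModuleCat.of R R))), t = 0 := by
  let e : (toAb U).obj (structureSheaf U) ≅ (restrictTilde j).obj (ModuleCat.of R R) :=
    (toAb U).mapIso (restrictUnitIso j).symm
  exact (((TopCat.Sheaf.pushforward AddCommGrpCat.{u} j.base).rightDerived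
    (i + 1)).mapIso e).isZero_iff.trans (isZero_rightDerived_pushforward_iff_cohStalk j.base _ i)

/-- If `U` is quasi-compact, then the higher direct images of the structure sheaf are torsion with
respect to functions vanishing outside of `U`. -/
lemma exists_pow_cohStalk_eq_zero [CompactSpace U] {f : R}
    (hf : specBasicOpen (R := .of R) f ≤ j.opensRange) {M : ModuleCat.{u} R} {x : Spec (.of R)}
    {i : ℕ} (t : (cohStalk j.base x (i + 1)).obj ((restrictTilde j).obj M)) :
    ∃ k : ℕ, (cohStalk j.base x (i + 1)).map ((restrictTilde j).map (f ^ k • 𝟙 M)) t = 0 := by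
  obtain ⟨V, hxV, ξ, rfl⟩ := cohStalk.exists_germ j.base t
  obtain ⟨_, ⟨_, ⟨h, rfl⟩, rfl⟩, hxh, hhV⟩ :=
    PrimeSpectrum.isBasis_basic_opens.exists_subset_of_mem_open hxV V.2
  let W : Opens (Spec (.of R)) := PrimeSpectrum.basicOpen h
  have hW : W ≤ V := hhV
  have hx : x ∈ W := hxh
  rw [← cohStalk.germ_res j.base hW hx]
  generalize Coh.res _ (i + 1) ((Opens.map j.base).map (homOfLE hW)).le ξ = ξ
  let A := associatedSheaves j
  -- Its image is the intersection of two quasi-compact open subsets of the affine scheme `Spec R`.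
  have hc : IsCompact ((Opens.map j.base).obj W : Set U) := by
    rw [j.isOpenEmbedding.isInducing.isCompact_iff]
    have : j '' ((Opens.map j.base).obj W : Set U) = Set.range j ∩ W :=
      (Set.image_preimage_eq_range_inter (f := j) (t := (W : Set (Spec (.of R)))) :)
    rw [this]
    exact (isCompact_range j.continuous).inter_of_isOpen (PrimeSpectrum.isCompact_basicOpen h)
      j.opensRange.2 W.2
  have hfh : A.D (f * h) ≤ (Opens.map j.base).obj W := by
    rw [A.D_mul]
    exact inf_le_right
  obtain ⟨k, hk⟩ := A.exists_pow_coh_eq_zero hc hf le_rfl hfh ξ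
  refine ⟨k, ?_⟩
  rw [cohStalk.map_germ]
  exact (congrArg _ hk).trans (map_zero _)

end AlgebraicGeometry.Scheme.Modules

end

open AlgebraicGeometry.Scheme.Modules TopCat.Sheaf in
theorem theorem5p1 {R : Type u} [CommRing R] {U : Scheme.{u}} (j : U ⟶ Spec (.of R))
    [IsOpenImmersion j] (n : ℕ) (G : ChainComplex (ModuleCat.{u} R) ℕ)
    [∀ i, Module.Free R (G.X i)] [∀ i, Module.Finite R (G.X i)]
    (hG : ∀ i, n < i → Limits.IsZero (G.X i))
    (hU : (Scheme.Modules.restrictComplex j (Scheme.Modules.tildeComplex G)).IsAcyclic) :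
    (1 ≤ n → Limits.IsZero ((Scheme.Modules.tensorDirectImage G j).homology n)) ∧
    (2 ≤ n → Limits.IsZero ((Scheme.Modules.tensorDirectImage G j).homology (n - 1))) ∧
    ((∀ i : ℕ, 1 ≤ i → i + 2 ≤ n →
        Limits.IsZero (Scheme.Modules.higherDirectImage j i (Scheme.Modules.structureSheaf U))) →
      (Scheme.Modules.tensorDirectImage G j).IsAcyclic) ∧
    (CompactSpace U →
      (Set.range j)ᶜ ⊆ PrimeSpectrum.zeroLocus
        (idealOfMaximalMinors (G.d n (n - 1)).hom : Set R) →
      ((Scheme.Modules.tensorDirectImage G j).IsAcyclic ↔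
        ∀ i : ℕ, 1 ≤ i → i + 2 ≤ n →
          Limits.IsZero
            (Scheme.Modules.higherDirectImage j i (Scheme.Modules.structureSheaf U)))) := by
  have hC (i : ℕ) (hi : 0 < i) : (restrictTildeComplex j G).ExactAt i := by
    obtain ⟨p, rfl⟩ : ∃ p, i = p + 1 := ⟨i - 1, by omega⟩
    exact (exactAt_restrictComplex_iff j G p).1 (hU _ hi)
  have hn (i : ℕ) (hi : n < i) : Limits.IsZero ((restrictTildeComplex j G).X i) :=
    (restrictTilde j).map_isZero (hG i hi)
  have h₁ (p : ℕ) (hp : n ≤ p + 2) : (tensorDirectImage G j).ExactAt (p + 1) :=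
    (exactAt_tensorDirectImage_iff j G p).2 fun x s hs ↦
      (cohStalkFunctor j.base x).exact_of_le hC hn hp s hs
  have h₂ (h : ∀ i : ℕ, 1 ≤ i → i + 2 ≤ n →
      Limits.IsZero (higherDirectImage j i (structureSheaf U))) :
      (tensorDirectImage G j).IsAcyclic := by
    intro i hi
    obtain ⟨p, rfl⟩ : ∃ p, i = p + 1 := ⟨i - 1, by omega⟩
    refine (exactAt_tensorDirectImage_iff j G p).2 fun x s hs ↦
      (cohStalkFunctor j.base x).exact_of_cohomology_eq_zero hC hn (fun k m hk hkn ξ ↦ ?_) s hs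
    obtain ⟨k, rfl⟩ : ∃ q, k = q + 1 := ⟨k - 1, by omega⟩
    exact cohStalk_restrictTilde_eq_zero j
      ((isZero_higherDirectImage_iff j k).1 (h _ hk hkn) x) (G.X m) ξ
  refine ⟨fun h ↦ ?_, fun h ↦ ?_, h₂, fun hc hI ↦ ⟨fun hT i ↦ ?_, h₂⟩⟩
  · obtain ⟨p, rfl⟩ : ∃ p, n = p + 1 := ⟨n - 1, by omega⟩
    exact (HomologicalComplex.exactAt_iff_isZero_homology _ _).1 (h₁ p (by omega))
  · obtain ⟨p, rfl⟩ : ∃ p, n = p + 2 := ⟨n - 2, by omega⟩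
    exact (HomologicalComplex.exactAt_iff_isZero_homology _ _).1 (h₁ p le_rfl)
  -- Vanishing in degrees below `i` makes the last differential injective on the stalks of `Hⁱ`;
  -- McCoy's theorem then reduces the claim to torsion with respect to the maximal minors.
  · induction i using Nat.strong_induction_on with
    | _ i ih =>
    intro hi hin
    obtain ⟨i, rfl⟩ : ∃ q, i = q + 1 := ⟨i - 1, by omega⟩
    refine (isZero_higherDirectImage_iff j i).2 fun x t ↦ ?_
    refine eq_zero_of_forall_minor_pow (restrictTilde j ⋙ cohStalk j.base x (i + 1))
      (G.d n (n - 1)) (fun ξ hξ ↦ ?_) t fun f hf ↦ ?_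
    · refine (cohStalkFunctor j.base x).eq_zero_of_map_d_eq_zero hC hn
        (fun p s hs ↦ (exactAt_tensorDirectImage_iff j G p).1 (hT _ (by omega)) x s hs) hi hin
        (fun k m hk hki η ↦ ?_) ξ hξ
      obtain ⟨k, rfl⟩ : ∃ q, k = q + 1 := ⟨k - 1, by omega⟩
      exact cohStalk_restrictTilde_eq_zero j
        ((isZero_higherDirectImage_iff j k).1 (ih _ hki hk (by omega)) x) (G.X m) η
    -- A point outside `U` lies in `V(I(d_n))`, so `f` vanishes there; hence `D(f)` is contained in
    -- `U`.
    · refine exists_pow_cohStalk_eq_zero j (fun y hy ↦ ?_) t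
      by_contra hy'
      exact hy (hI hy' hf)
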